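/- Let $r\ge 1$ be an integer, $a>0$ and $\mathbf w=(w_1,\dots,w_r)\in\mathbb{R}_{>0}^r$. The series $$\zeta_r(s,a,\mathbf w)=\sum_{m_1,\dots,m_r\ge 0}\frac{1}{(a+m_1w_1+\cdots+m_rw_r)^{s}}$$ converges absolutely for $\operatorname{Re}s>r$ and has a meromorphic continuation to $\mathbb{C}$, again denoted $\zeta_r(s,a,\mathbf w)$ (the Barnes multiple zeta function), which is holomorphic away from $s=1,2,\dots,r$. Write $s=\sigma+it$. Then for all $t\ge 2$ $$ \zeta_r(\sigma+it,a,\mathbf w)\ll \begin{cases} 1 & \text{if } \sigma>r,\\ t^{(r-\sigma)/2}\log t & \text{if } r-1<\sigma\le r,\\ t^{\,r-\sigma-1/2}\log t & \text{if } \sigma\le r-1. \end{cases} $$ The implied constants depend on $a$, $r$, $\mathbf w$ and the following range of $\sigma$. In the first case, for any $r<\sigma_0\le\sigma_1$, the bound is uniform in $\sigma_0\le\sigma\le\sigma_1$, with a constant depending also on $\sigma_0,\sigma_1$. In the second case it is uniform in the whole strip $r-1<\sigma\le r$, with a constant depending only on $a,r,\mathbf w$. In the third case, for any $\sigma_0\le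 r-1$, it is uniform in $\sigma_0\le\sigma\le r-1$, with a constant depending also on $\sigma_0$. -/

import Mathlib

/-- `Z` is the meromorphic continuation to `ℂ` of the Barnes multiple zeta series
`∑_{m ∈ ℕ^r} (a + m₁ w₁ + ⋯ + m_r w_r)^{-s}`: the series converges (absolutely) to `Z s` for
`Re s > r`, and `Z` is meromorphic on `ℂ` and holomorphic away from `s = 1, …, r`.
By the identity theorem such a `Z` is unique away from `1, …, r`. -/
structure IsBarnesContinuation (r : ℕ) (a : ℝ) (w : Fin r → ℝ) (Z : ℂ → ℂ) : Prop where
  hasSum : ∀ s : ℂ, (r : ℝ) < s.re →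
    HasSum (fun m : Fin r → ℕ ↦ 1 / ((a + ∑ j, (m j : ℝ) * w j : ℝ) : ℂ) ^ s) (Z s)
  meromorphic : Meromorphic Z
  differentiableOn : DifferentiableOn ℂ Z {s : ℂ | ∀ k : ℕ, 1 ≤ k → k ≤ r → s ≠ (k : ℂ)}

open Classical in
/-- The Barnes multiple zeta function `ζ_r(s, a, w)` on the whole complex plane. The values at the
points `s = 1, …, r` are arbitrary; the fallback value `0` matters only if no continuation exists,
which does not happen for `r ≥ 1` and `a, w_j > 0`. -/
noncomputable def barnesZeta (r : ℕ) (a : ℝ) (w : Fin r → ℝ) : ℂ → ℂ :=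
  if h : ∃ Z : ℂ → ℂ, IsBarnesContinuation r a w Z then h.choose else 0

open Set Filter Topology MeasureTheory

/-! ### Integrals depending on a complex parameter -/

/-- A parametric integral of a jointly continuous function that is holomorphic in the parameter
is holomorphic. -/
theorem differentiableOn_intervalIntegral_of_continuousOn {V : Set ℂ} (hV : IsOpen V) {b : ℝ}
    (hb : 0 ≤ b) {f : ℂ → ℝ → ℂ}
    (hc : ContinuousOn (fun p : ℂ × ℝ ↦ f p.1 p.2) (V ×ˢ Icc 0 b))
    (hd : ∀ u ∈ Icc 0 b, DifferentiableOn ℂ (fun s ↦ f s u) V) :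
    DifferentiableOn ℂ (fun s ↦ ∫ u in (0 : ℝ)..b, f s u) V := by
  intro s₀ hs₀
  obtain ⟨ρ', hρ', hball'⟩ := Metric.isOpen_iff.1 hV s₀ hs₀
  -- Circles of radius ρ about points of the ρ-ball stay in the closed 2ρ-ball, so Cauchy's estimate
  -- bounds the derivative by `B / ρ`.
  obtain ⟨ρ, hρ, hρρ⟩ : ∃ ρ : ℝ, 0 < ρ ∧ ρ + ρ < ρ' := ⟨ρ' / 3, by linarith, by linarith⟩
  have hball : Metric.closedBall s₀ (ρ + ρ) ⊆ V :=
    (Metric.closedBall_subset_ball hρρ).trans hball'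
  have hcomp : IsCompact (Metric.closedBall s₀ (ρ + ρ) ×ˢ Icc (0 : ℝ) b) :=
    (isCompact_closedBall _ _).prod isCompact_Icc
  obtain ⟨B, hB⟩ := hcomp.exists_bound_of_continuousOn (hc.mono (prod_mono hball Subset.rfl))
  have hmemV : ∀ z ∈ Metric.ball s₀ ρ, z ∈ V := fun z hz ↦ hball
    (Metric.ball_subset_closedBall (Metric.ball_subset_ball (by linarith) hz))
  have hcu : ∀ z ∈ V, ContinuousOn (f z) (Icc 0 b) := fun z hz ↦
    hc.comp (f := fun u ↦ (z, u)) (by fun_prop) (fun u hu ↦ ⟨hz, hu⟩)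
  have hsub : uIoc 0 b ⊆ Icc 0 b := by
    rw [uIoc_of_le hb]; exact Ioc_subset_Icc_self
  have hmeas : ∀ z ∈ V, AEStronglyMeasurable (f z) (volume.restrict (uIoc 0 b)) := fun z hz ↦
    ((hcu z hz).mono hsub).aestronglyMeasurable measurableSet_uIoc
  have hder : ∀ u ∈ uIoc 0 b, ∀ z ∈ Metric.ball s₀ ρ,
      HasDerivAt (fun s ↦ f s u) (deriv (fun s ↦ f s u) z) z := fun u hu z hz ↦
    ((hd u (hsub hu)).differentiableAt (hV.mem_nhds (hmemV z hz))).hasDerivAt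
  have key := intervalIntegral.hasDerivAt_integral_of_dominated_loc_of_deriv_le (𝕜 := ℂ)
    (μ := volume) (a := 0) (b := b) (F := f) (F' := fun s u ↦ deriv (fun s ↦ f s u) s)
    (x₀ := s₀) (s := Metric.ball s₀ ρ) (bound := fun _ ↦ B / ρ)
    (Metric.ball_mem_nhds s₀ hρ)
    (by filter_upwards [hV.mem_nhds hs₀] with z hz using hmeas z hz)
    (by
      rw [intervalIntegrable_iff_integrableOn_Icc_of_le hb]
      exact (hcu s₀ hs₀).integrableOn_Icc)
    (by
      -- The derivative at `s₀` is measurable in `u` as a pointwise limit of difference quotients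
      -- along this sequence.
      have hlim : Tendsto (fun n : ℕ ↦ s₀ + ((ρ / 2 * (1 / ((n : ℝ) + 1)) : ℝ) : ℂ)) atTop
          (𝓝[≠] s₀) := by
        rw [tendsto_nhdsWithin_iff]
        constructor
        · have h1 : Tendsto (fun n : ℕ ↦ (ρ / 2 * (1 / ((n : ℝ) + 1)) : ℝ)) atTop (𝓝 0) := by
            simpa using tendsto_one_div_add_atTop_nhds_zero_nat.const_mul (ρ / 2)
          have h2 := (Complex.continuous_ofReal.tendsto 0).comp h1
          simpa using h2.const_add s₀
        · refine Eventually.of_forall fun n ↦ ?_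
          have : (ρ / 2 * (1 / ((n : ℝ) + 1)) : ℝ) ≠ 0 := by positivity
          simpa only [mem_compl_iff, mem_singleton_iff, add_eq_left, Complex.ofReal_eq_zero]
      refine aestronglyMeasurable_of_tendsto_ae atTop
        (f := fun n : ℕ ↦ fun u ↦ slope (fun s ↦ f s u) s₀
          (s₀ + ((ρ / 2 * (1 / ((n : ℝ) + 1)) : ℝ) : ℂ))) (fun n ↦ ?_) ?_
      · simp only [slope_def_module]
        refine AEStronglyMeasurable.const_smul ((hmeas _ (hmemV _ ?_)).sub (hmeas s₀ hs₀)) (_ : ℂ)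
        rw [Metric.mem_ball, dist_eq_norm, add_sub_cancel_left, Complex.norm_real,
          Real.norm_of_nonneg (by positivity)]
        have : 1 / ((n : ℝ) + 1) ≤ 1 := by
          rw [div_le_one (by positivity)]; linarith [(Nat.cast_nonneg n : (0 : ℝ) ≤ n)]
        nlinarith
      · rw [ae_restrict_iff' measurableSet_uIoc]
        refine Eventually.of_forall fun u hu ↦ ?_
        exact (hasDerivAt_iff_tendsto_slope.1
          (hder u hu s₀ (Metric.mem_ball_self hρ))).comp hlim)
    (by
      refine Eventually.of_forall fun u hu z hz ↦ ?_
      refine Complex.norm_deriv_le_of_forall_mem_sphere_norm_le hρ ?_ ?_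
      · refine ((hd u (hsub hu)).mono ?_).diffContOnCl
        rw [closure_ball _ hρ.ne']
        refine (Metric.closedBall_subset_closedBall' ?_).trans hball
        linarith [Metric.mem_ball.1 hz]
      · intro y hy
        refine hB (y, u) ⟨?_, hsub hu⟩
        have := dist_triangle y z s₀
        rw [Metric.mem_closedBall]
        rw [Metric.mem_sphere] at hy
        linarith [Metric.mem_ball.1 hz])
    intervalIntegrable_const
    (Eventually.of_forall fun u hu z hz ↦ hder u hu z hz)
  exact key.2.differentiableAt.differentiableWithinAt

/-- Joint continuity of `(s, x) ↦ ∫ u in 0..b, (b - u) * F (s + 1) (x + u)`. -/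
theorem continuousOn_shift_integral {V : Set ℂ} {b : ℝ} (hb : 0 ≤ b) {F : ℂ → ℝ → ℂ}
    (hF : ContinuousOn (fun p : ℂ × ℝ ↦ F p.1 p.2) (V ×ˢ Ioi 0)) :
    ContinuousOn (fun p : ℂ × ℝ ↦ ∫ u in (0 : ℝ)..b, ((b - u : ℝ) : ℂ) * F (p.1 + 1) (p.2 + u))
      ({s | s + 1 ∈ V} ×ˢ Ioi 0) := by
  rw [continuousOn_iff_continuous_domRestrict]
  -- Replacing `u` by `|u|` changes nothing on `[0, b]` and keeps the argument positive for every
  -- real `u`, so the integrand becomes continuous everywhere.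
  have h1 : ∀ p : ↥({s : ℂ | s + 1 ∈ V} ×ˢ Ioi (0 : ℝ)),
      (∫ u in (0 : ℝ)..b, ((b - u : ℝ) : ℂ) * F (p.1.1 + 1) (p.1.2 + u)) =
      ∫ u in (0 : ℝ)..b, ((b - u : ℝ) : ℂ) * F (p.1.1 + 1) (p.1.2 + |u|) := fun p ↦ by
    refine intervalIntegral.integral_congr fun u hu ↦ ?_
    rw [uIcc_of_le hb] at hu
    simp only [abs_of_nonneg hu.1]
  have h2 : Continuous (fun p : ↥({s : ℂ | s + 1 ∈ V} ×ˢ Ioi (0 : ℝ)) ↦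
      ∫ u in (0 : ℝ)..b, ((b - u : ℝ) : ℂ) * F (p.1.1 + 1) (p.1.2 + |u|)) := by
    refine intervalIntegral.continuous_parametric_intervalIntegral_of_continuous' ?_ _ _
    refine Continuous.mul (by fun_prop) ?_
    exact hF.comp_continuous
      (f := fun q : ↥({s : ℂ | s + 1 ∈ V} ×ˢ Ioi (0 : ℝ)) × ℝ ↦ (q.1.1.1 + 1, q.1.1.2 + |q.2|))
      (by fun_prop)
      (fun q ↦ ⟨q.1.2.1, mem_Ioi.2 (add_pos_of_pos_of_nonneg q.1.2.2 (abs_nonneg _))⟩)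
  exact (continuous_congr h1).2 h2

/-! ### The linear form and absolute convergence of the series -/

/-- The linear form `x + m₁ w₁ + ⋯ + m_r w_r`. -/
def barnesLin {r : ℕ} (w : Fin r → ℝ) (x : ℝ) (m : Fin r → ℕ) : ℝ := x + ∑ j, (m j : ℝ) * w j

theorem barnesLin_cons {r : ℕ} (w : Fin (r + 1) → ℝ) (x : ℝ) (n : ℕ) (m : Fin r → ℕ) :
    barnesLin w x (Fin.cons n m) = barnesLin (Fin.tail w) x m + n * w 0 := by
  simp only [barnesLin, Fin.sum_univ_succ, Fin.cons_zero, Fin.cons_succ, Fin.tail]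
  ring

theorem barnesLin_add {r : ℕ} (w : Fin r → ℝ) (x u : ℝ) (m : Fin r → ℕ) :
    barnesLin w (x + u) m = barnesLin w x m + u := by
  simp only [barnesLin]; ring

theorem le_barnesLin {r : ℕ} {w : Fin r → ℝ} (hw : ∀ j, 0 < w j) (x : ℝ) (m : Fin r → ℕ) :
    x ≤ barnesLin w x m :=
  le_add_of_nonneg_right (Finset.sum_nonneg fun j _ ↦ mul_nonneg (Nat.cast_nonneg _) (hw j).le)

theorem barnesLin_pos {r : ℕ} {w : Fin r → ℝ} (hw : ∀ j, 0 < w j) {x : ℝ} (hx : 0 < x)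
    (m : Fin r → ℕ) : 0 < barnesLin w x m :=
  hx.trans_le (le_barnesLin hw x m)

theorem barnesLin_mono {r : ℕ} (w : Fin r → ℝ) {x y : ℝ} (hxy : x ≤ y)
    (m : Fin r → ℕ) : barnesLin w x m ≤ barnesLin w y m := by
  simp only [barnesLin]; linarith

/-- The equivalence splitting off the zeroth coordinate, put last. -/
def finSuccFunEquiv (r : ℕ) : (Fin r → ℕ) × ℕ ≃ (Fin (r + 1) → ℕ) :=
  (Equiv.prodComm _ _).trans (Fin.consEquiv (fun _ ↦ ℕ))

theorem barnesLin_finSuccFunEquiv {r : ℕ} (w : Fin (r + 1) → ℝ) (x : ℝ) (q : (Fin r → ℕ) × ℕ) :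
    barnesLin w x (finSuccFunEquiv r q) = barnesLin (Fin.tail w) x q.1 + q.2 * w 0 :=
  barnesLin_cons w x q.2 q.1

/-- A discrete substitute for comparing a sum with an integral. It reduces to `(v/u)^q ≥ 1 + q (1 -
u/v)`, which follows from `exp x ≥ 1 + x` and `log x ≥ 1 - 1/x`. -/
theorem rpow_neg_add_one_mul_le_sub {u v q : ℝ} (hu : 0 < u) (huv : u ≤ v) (hq : 0 ≤ q) :
    q * (v - u) * v ^ (-(q + 1)) ≤ u ^ (-q) - v ^ (-q) := by
  have hv : 0 < v := hu.trans_le huv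
  have h1 : 1 - u / v ≤ Real.log (v / u) := by
    have := Real.one_sub_inv_le_log_of_pos (div_pos hv hu)
    rwa [inv_div] at this
  have h2 : 1 + q * (1 - u / v) ≤ (v / u) ^ q := by
    rw [Real.rpow_def_of_pos (div_pos hv hu)]
    have := Real.add_one_le_exp (Real.log (v / u) * q)
    nlinarith
  have h3 : u ^ (-q) = (v / u) ^ q * v ^ (-q) := by
    rw [Real.div_rpow hv.le hu.le, Real.rpow_neg hu.le, Real.rpow_neg hv.le]
    have := (Real.rpow_pos_of_pos hv q).ne'
    field_simp
  have h4 : v ^ (-q) = v * v ^ (-(q + 1)) := by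
    rw [show -q = -(q + 1) + 1 by ring, Real.rpow_add_one hv.ne', mul_comm]
  have h5 : 0 < v ^ (-(q + 1)) := Real.rpow_pos_of_pos hv _
  have h6 : q * (1 - u / v) * v = q * (v - u) := by field_simp
  calc q * (v - u) * v ^ (-(q + 1)) = q * (1 - u / v) * v ^ (-q) := by rw [h4, ← h6]; ring
    _ ≤ ((v / u) ^ q - 1) * v ^ (-q) := by
        refine mul_le_mul_of_nonneg_right (by linarith) (Real.rpow_pos_of_pos hv _).le
    _ = _ := by rw [h3]; ring

theorem sum_range_rpow_le {y w p : ℝ} (hy : 0 < y) (hw : 0 < w) (hp : 1 < p) (n : ℕ) :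
    ∑ i ∈ Finset.range n, (y + i * w) ^ (-p) ≤ y ^ (-p) + y ^ (1 - p) / (w * (p - 1)) := by
  have hpos : ∀ i : ℕ, 0 < y + i * w := fun i ↦ by positivity
  have hc : 0 < w * (p - 1) := mul_pos hw (by linarith)
  have key : ∀ n : ℕ, ∑ i ∈ Finset.range (n + 1), (y + i * w) ^ (-p) ≤
      y ^ (-p) + (y ^ (1 - p) - (y + n * w) ^ (1 - p)) / (w * (p - 1)) := by
    intro n
    induction n with
    | zero => simp
    | succ n ih =>
      rw [Finset.sum_range_succ]
      have h := rpow_neg_add_one_mul_le_sub (hpos n)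
        (show y + n * w ≤ y + ((n + 1 : ℕ) : ℝ) * w by push_cast; nlinarith)
        (show 0 ≤ p - 1 by linarith)
      have e1 : -(p - 1 + 1) = -p := by ring
      have e2 : -(p - 1) = 1 - p := by ring
      rw [e1, e2] at h
      have e3 : (p - 1) * (y + ((n + 1 : ℕ) : ℝ) * w - (y + n * w)) = w * (p - 1) := by
        push_cast; ring
      rw [e3] at h
      have h' := (le_div_iff₀' hc).2 h
      have := add_le_add ih h'
      refine this.trans (le_of_eq ?_)
      rw [add_assoc, ← add_div]; congr 2; ring
  rcases n with _ | n
  · simp only [Finset.range_zero, Finset.sum_empty]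
    have := Real.rpow_nonneg hy.le (-p)
    have := Real.rpow_nonneg hy.le (1 - p)
    positivity
  · refine (key n).trans ?_
    gcongr
    have := Real.rpow_nonneg (hpos n).le (1 - p)
    linarith

/-- Summing over one coordinate costs one power of the linear form, so induction on `r` lowers `p`
to `p - 1`. The power of `x` in the bound is needed later, when the shift is large. -/
theorem barnes_summable_bound (r : ℕ) : ∀ (w : Fin r → ℝ), (∀ j, 0 < w j) → ∀ p : ℝ, (r : ℝ) < p →
    ∀ x₀ : ℝ, 0 < x₀ → ∃ A : ℝ, 0 ≤ A ∧ ∀ x, x₀ ≤ x →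
      Summable (fun m : Fin r → ℕ ↦ barnesLin w x m ^ (-p)) ∧
      ∑' m : Fin r → ℕ, barnesLin w x m ^ (-p) ≤ A * x ^ ((r : ℝ) - p) := by
  induction r with
  | zero =>
    intro w hw p hp x₀ hx₀
    refine ⟨1, zero_le_one, fun x hx ↦ ⟨(hasSum_fintype _).summable, ?_⟩⟩
    simp [barnesLin]
  | succ r ih =>
    intro w hw p hp x₀ hx₀
    push_cast at hp
    obtain ⟨A, hA0, hA⟩ := ih (Fin.tail w) (fun j ↦ hw _) (p - 1) (by linarith) x₀ hx₀
    have hp1 : 0 < p - 1 := by have : (0 : ℝ) ≤ r := Nat.cast_nonneg r; linarith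
    -- The first summand of `c` absorbs the leading term, since `y^(-p) ≤ y^(1-p) / x₀`; the second
    -- comes from the comparison with an integral.
    set c : ℝ := 1 / x₀ + 1 / (w 0 * (p - 1)) with hc
    have hw0 := hw 0
    have hc0 : 0 ≤ c := by positivity
    refine ⟨c * A, by positivity, fun x hx ↦ ?_⟩
    obtain ⟨hs, hb⟩ := hA x hx
    have hx0 : 0 < x := hx₀.trans_le hx
    have hL : ∀ m, x ≤ barnesLin (Fin.tail w) x m := le_barnesLin (fun j ↦ hw _) x
    have hin : ∀ m : Fin r → ℕ, ∀ n : ℕ, ∑ i ∈ Finset.range n,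
        (barnesLin (Fin.tail w) x m + i * w 0) ^ (-p) ≤
        c * barnesLin (Fin.tail w) x m ^ (-(p - 1)) := by
      intro m n
      have hy := hx0.trans_le (hL m)
      refine (sum_range_rpow_le hy hw0 (by linarith) n).trans ?_
      have e : barnesLin (Fin.tail w) x m ^ (-p) ≤
          1 / x₀ * barnesLin (Fin.tail w) x m ^ (-(p - 1)) := by
        rw [show -p = -(p - 1) - 1 by ring, Real.rpow_sub_one hy.ne', div_eq_inv_mul, one_div]
        gcongr
        exact hx.trans (hL m)
      rw [hc, add_mul, show 1 - p = -(p - 1) by ring]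
      refine add_le_add e (le_of_eq ?_)
      ring
    have hnn : ∀ m n, 0 ≤ (barnesLin (Fin.tail w) x m + (n : ℕ) * w 0) ^ (-p) := fun m n ↦
      Real.rpow_nonneg (add_nonneg (hx0.le.trans (hL m)) (by positivity)) _
    have hsin : ∀ m, Summable fun n : ℕ ↦ (barnesLin (Fin.tail w) x m + n * w 0) ^ (-p) := fun m ↦
      summable_of_sum_range_le (hnn m) (hin m)
    have hle : ∀ m, ∑' n : ℕ, (barnesLin (Fin.tail w) x m + n * w 0) ^ (-p) ≤
        c * barnesLin (Fin.tail w) x m ^ (-(p - 1)) := fun m ↦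
      Real.tsum_le_of_sum_range_le (hnn m) (hin m)
    have hsc := hs.mul_left c
    have hsout : Summable fun m ↦ ∑' n : ℕ, (barnesLin (Fin.tail w) x m + n * w 0) ^ (-p) :=
      Summable.of_nonneg_of_le (fun m ↦ tsum_nonneg (hnn m)) hle hsc
    have hprod : Summable fun q : (Fin r → ℕ) × ℕ ↦
        (barnesLin (Fin.tail w) x q.1 + q.2 * w 0) ^ (-p) :=
      (summable_prod_of_nonneg (fun q ↦ hnn q.1 q.2)).2 ⟨hsin, hsout⟩
    have hcomp : (fun q : (Fin r → ℕ) × ℕ ↦ (barnesLin (Fin.tail w) x q.1 + q.2 * w 0) ^ (-p)) =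
        (fun m ↦ barnesLin w x m ^ (-p)) ∘ finSuccFunEquiv r := by
      funext q; simp only [Function.comp, barnesLin_finSuccFunEquiv]
    refine ⟨(finSuccFunEquiv r).summable_iff.1 (hcomp ▸ hprod), ?_⟩
    rw [← (finSuccFunEquiv r).tsum_eq]
    have : ∑' q, barnesLin w x (finSuccFunEquiv r q) ^ (-p) =
        ∑' q : (Fin r → ℕ) × ℕ, (barnesLin (Fin.tail w) x q.1 + q.2 * w 0) ^ (-p) := by
      rw [hcomp]; rfl
    rw [this, hprod.tsum_prod' hsin]
    refine (hsout.tsum_le_tsum hle hsc).trans ?_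
    rw [tsum_mul_left, mul_assoc]
    push_cast
    rw [show (r : ℝ) + 1 - p = r - (p - 1) by ring]
    gcongr

theorem barnes_summable_rpow {r : ℕ} {w : Fin r → ℝ} (hw : ∀ j, 0 < w j) {p x : ℝ}
    (hp : (r : ℝ) < p) (hx : 0 < x) :
    Summable (fun m : Fin r → ℕ ↦ barnesLin w x m ^ (-p)) := by
  obtain ⟨A, -, hA⟩ := barnes_summable_bound r w hw p hp x hx
  exact (hA x le_rfl).1

theorem norm_ofReal_cpow_neg {y : ℝ} (hy : 0 < y) (s : ℂ) : ‖(y : ℂ) ^ (-s)‖ = y ^ (-s.re) := by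
  rw [Complex.norm_cpow_eq_rpow_re_of_pos hy, Complex.neg_re]

theorem barnes_summable_cpow {r : ℕ} {w : Fin r → ℝ} (hw : ∀ j, 0 < w j) {s : ℂ} {x : ℝ}
    (hs : (r : ℝ) < s.re) (hx : 0 < x) :
    Summable (fun m : Fin r → ℕ ↦ (barnesLin w x m : ℂ) ^ (-s)) := by
  refine Summable.of_norm ?_
  simpa only [norm_ofReal_cpow_neg (barnesLin_pos hw hx _)] using barnes_summable_rpow hw hs hx

/-- The Barnes multiple zeta series (meaningful for `r < re s`). -/
noncomputable def barnesSeries {r : ℕ} (w : Fin r → ℝ) (s : ℂ) (x : ℝ) : ℂ :=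
  ∑' m : Fin r → ℕ, (barnesLin w x m : ℂ) ^ (-s)

/-- This supplies one summable majorant for a whole vertical strip. The maximum is there because `y`
may be smaller than 1. -/
theorem rpow_neg_le_max_mul {x₁ y p p' σ : ℝ} (hx : 0 < x₁) (hy : x₁ ≤ y) (h1 : p ≤ σ)
    (h2 : σ ≤ p') : y ^ (-σ) ≤ max 1 (x₁ ^ (-(p' - p))) * y ^ (-p) := by
  have hy0 := hx.trans_le hy
  rw [show -σ = -(σ - p) + -p by ring, Real.rpow_add hy0]
  refine mul_le_mul_of_nonneg_right ?_ (Real.rpow_nonneg hy0.le _)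
  rcases le_total 1 y with h | h
  · exact (Real.rpow_le_one_of_one_le_of_nonpos h (by linarith)).trans (le_max_left _ _)
  · refine le_trans ?_ (le_max_right _ _)
    refine (Real.rpow_le_rpow_of_exponent_ge hy0 h (by linarith : -(p' - p) ≤ -(σ - p))).trans ?_
    exact Real.rpow_le_rpow_of_nonpos hx hy (by linarith)

theorem norm_cpow_barnesLin_le {r : ℕ} {w : Fin r → ℝ} (hw : ∀ j, 0 < w j) {x₁ x p p' : ℝ}
    (hr : 0 ≤ p) (hx₁ : 0 < x₁) (hx : x₁ ≤ x) {s : ℂ} (h1 : p ≤ s.re) (h2 : s.re ≤ p')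
    (m : Fin r → ℕ) : ‖(barnesLin w x m : ℂ) ^ (-s)‖ ≤
      max 1 (x₁ ^ (-(p' - p))) * barnesLin w x₁ m ^ (-p) := by
  have h0 := barnesLin_pos hw hx₁ m
  have h3 := barnesLin_mono w hx m
  rw [norm_ofReal_cpow_neg (h0.trans_le h3)]
  refine (Real.rpow_le_rpow_of_nonpos h0 h3 (by linarith)).trans ?_
  exact rpow_neg_le_max_mul hx₁ (le_barnesLin hw x₁ m) h1 h2

theorem continuousAt_ofReal_cpow_neg {y : ℝ} (hy : 0 < y) {α : Type*} [TopologicalSpace α]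
    {f : α → ℝ} {g : α → ℂ} {a : α} (hf : ContinuousAt f a) (hg : ContinuousAt g a)
    (h : f a = y) : ContinuousAt (fun a ↦ (f a : ℂ) ^ (-(g a))) a := by
  refine ContinuousAt.cpow (Complex.continuous_ofReal.continuousAt.comp hf) hg.neg ?_
  rw [Complex.ofReal_mem_slitPlane, h]; exact hy

theorem continuousOn_barnesSeries {r : ℕ} {w : Fin r → ℝ} (hw : ∀ j, 0 < w j) :
    ContinuousOn (fun q : ℂ × ℝ ↦ barnesSeries w q.1 q.2) ({s | (r : ℝ) < s.re} ×ˢ Ioi 0) := by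
  rintro ⟨s₀, x₀⟩ ⟨hs₀, hx₀⟩
  simp only [mem_ofPred_eq, mem_Ioi] at hs₀ hx₀
  have hrn : (0 : ℝ) ≤ r := Nat.cast_nonneg r
  set U : Set (ℂ × ℝ) := {s : ℂ | ((r : ℝ) + s₀.re) / 2 < s.re ∧ s.re < s₀.re + 1} ×ˢ Ioi (x₀ / 2)
    with hU
  have hUo : IsOpen U :=
    ((isOpen_lt continuous_const Complex.continuous_re).inter
      (isOpen_lt Complex.continuous_re continuous_const)).prod isOpen_Ioi
  have hmem : (s₀, x₀) ∈ U := ⟨⟨by linarith, by linarith⟩, by simp only [mem_Ioi]; linarith⟩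
  refine ContinuousAt.continuousWithinAt (ContinuousOn.continuousAt ?_ (hUo.mem_nhds hmem))
  refine continuousOn_tsum (fun m ↦ ?_)
    ((barnes_summable_rpow hw (p := ((r : ℝ) + s₀.re) / 2) (by linarith)
      (half_pos hx₀)).mul_left _)
    (fun m q hq ↦ norm_cpow_barnesLin_le hw (by linarith) (half_pos hx₀) (le_of_lt hq.2)
      hq.1.1.le hq.1.2.le m)
  intro q hq
  refine (continuousAt_ofReal_cpow_neg (barnesLin_pos hw ((half_pos hx₀).trans hq.2) m)
    ?_ continuousAt_fst rfl).continuousWithinAt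
  unfold barnesLin
  fun_prop

theorem differentiableOn_barnesSeries {r : ℕ} {w : Fin r → ℝ} (hw : ∀ j, 0 < w j) {x : ℝ}
    (hx : 0 < x) : DifferentiableOn ℂ (fun s ↦ barnesSeries w s x) {s | (r : ℝ) < s.re} := by
  intro s₀ hs₀
  simp only [mem_ofPred_eq] at hs₀
  have hrn : (0 : ℝ) ≤ r := Nat.cast_nonneg r
  set U : Set ℂ := {s : ℂ | ((r : ℝ) + s₀.re) / 2 < s.re ∧ s.re < s₀.re + 1} with hU
  have hUo : IsOpen U := (isOpen_lt continuous_const Complex.continuous_re).inter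
      (isOpen_lt Complex.continuous_re continuous_const)
  have hmem : s₀ ∈ U := ⟨by linarith, by linarith⟩
  refine DifferentiableAt.differentiableWithinAt
    (DifferentiableOn.differentiableAt (s := U) ?_ (hUo.mem_nhds hmem))
  refine Complex.differentiableOn_tsum_of_summable_norm
    ((barnes_summable_rpow hw (p := ((r : ℝ) + s₀.re) / 2) (by linarith) hx).mul_left _)
    (fun m ↦ ?_) hUo
    (fun m s hs ↦ norm_cpow_barnesLin_le hw (by linarith) hx le_rfl hs.1.le hs.2.le m)
  refine (DifferentiableOn.const_cpow (by fun_prop) (Or.inl ?_))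
  exact_mod_cast (barnesLin_pos hw hx m).ne'

/-! ### Telescoping relations for the convergent series -/

/-- Taylor's formula with integral remainder, obtained by integrating the derivative of
`(s-1)(b-u)(y+u)^(-s) - (y+u)^(1-s)` from 0 to `b`. -/
theorem cpow_sub_cpow_add_eq {y b : ℝ} (hy : 0 < y) (hb : 0 ≤ b) (s : ℂ) :
    (y : ℂ) ^ (-(s - 1)) - ((y + b : ℝ) : ℂ) ^ (-(s - 1)) =
      (s - 1) * (b * (y : ℂ) ^ (-s) -
        s * ∫ u in (0 : ℝ)..b, ((b - u : ℝ) : ℂ) * ((y + u : ℝ) : ℂ) ^ (-(s + 1))) := by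
  have hpos : ∀ u ∈ uIcc 0 b, 0 < y + u := fun u hu ↦ by
    rw [uIcc_of_le hb] at hu; linarith [hu.1]
  have hpow : ∀ (c : ℂ), ∀ u ∈ uIcc 0 b,
      HasDerivAt (fun u : ℝ ↦ ((y + u : ℝ) : ℂ) ^ c) (c * ((y + u : ℝ) : ℂ) ^ (c - 1)) u := by
    intro c u hu
    have h1 : HasDerivAt (fun u : ℝ ↦ ((y + u : ℝ) : ℂ)) 1 u := by
      simpa using ((hasDerivAt_id u).const_add y).ofReal_comp
    have h2 := (hasDerivAt_id ((y + u : ℝ) : ℂ)).cpow_const (c := c)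
      (by rw [id, Complex.ofReal_mem_slitPlane]; exact hpos u hu)
    simpa [Function.comp_def] using h2.comp u h1
  have hder : ∀ u ∈ uIcc 0 b, HasDerivAt
      (fun u : ℝ ↦ (s - 1) * (((b - u : ℝ) : ℂ) * ((y + u : ℝ) : ℂ) ^ (-s)) -
        ((y + u : ℝ) : ℂ) ^ (-(s - 1)))
      (-((s - 1) * s) * (((b - u : ℝ) : ℂ) * ((y + u : ℝ) : ℂ) ^ (-(s + 1)))) u := by
    intro u hu
    have h1 : HasDerivAt (fun u : ℝ ↦ ((b - u : ℝ) : ℂ)) (-1) u := by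
      simpa using ((hasDerivAt_id u).const_sub b).ofReal_comp
    have h2 := ((h1.mul (hpow (-s) u hu)).const_mul (s - 1)).sub (hpow (-(s - 1)) u hu)
    refine h2.congr_deriv ?_
    rw [show -s - 1 = -(s + 1) by ring, show -(s - 1) - 1 = -s by ring]
    ring
  have hint : IntervalIntegrable (fun u : ℝ ↦ -((s - 1) * s) *
      (((b - u : ℝ) : ℂ) * ((y + u : ℝ) : ℂ) ^ (-(s + 1)))) volume 0 b := by
    refine ContinuousOn.intervalIntegrable fun u hu ↦ ?_
    refine ContinuousAt.continuousWithinAt ?_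
    exact continuousAt_const.mul ((by fun_prop : Continuous fun u : ℝ ↦ ((b - u : ℝ) : ℂ)).continuousAt.mul
      (hpow _ u hu).continuousAt)
  have h := intervalIntegral.integral_eq_sub_of_hasDerivAt hder hint
  rw [intervalIntegral.integral_const_mul] at h
  simp only [sub_self, sub_zero, add_zero, Complex.ofReal_zero, zero_mul, mul_zero, zero_sub] at h
  linear_combination -h

theorem hasSum_barnesSeries {r : ℕ} {w : Fin r → ℝ} (hw : ∀ j, 0 < w j) {s : ℂ} {x : ℝ}
    (hs : (r : ℝ) < s.re) (hx : 0 < x) :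
    HasSum (fun m : Fin r → ℕ ↦ (barnesLin w x m : ℂ) ^ (-s)) (barnesSeries w s x) :=
  (barnes_summable_cpow hw hs hx).hasSum

theorem hasSum_integral_barnesSeries {r : ℕ} {w : Fin r → ℝ} (hw : ∀ j, 0 < w j) {s : ℂ} {x b : ℝ}
    (hs : (r : ℝ) < s.re) (hx : 0 < x) (hb : 0 ≤ b) :
    HasSum (fun m : Fin r → ℕ ↦ ∫ u in (0 : ℝ)..b, ((b - u : ℝ) : ℂ) *
        ((barnesLin w x m + u : ℝ) : ℂ) ^ (-s))
      (∫ u in (0 : ℝ)..b, ((b - u : ℝ) : ℂ) * barnesSeries w s (x + u)) := by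
  have hsub : uIoc 0 b ⊆ Icc 0 b := by
    rw [uIoc_of_le hb]; exact Ioc_subset_Icc_self
  have hrn : (0 : ℝ) ≤ r := Nat.cast_nonneg r
  have hbd := (barnes_summable_rpow hw hs hx).mul_left b
  refine intervalIntegral.hasSum_integral_of_dominated_convergence
    (fun m _ ↦ b * barnesLin w x m ^ (-s.re)) (fun m ↦ ?_) (fun m ↦ ?_) ?_ ?_ ?_
  · refine ContinuousOn.aestronglyMeasurable (fun u hu ↦ ?_) measurableSet_uIoc
    refine ContinuousAt.continuousWithinAt (ContinuousAt.mul (by fun_prop) ?_)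
    exact continuousAt_ofReal_cpow_neg (add_pos_of_pos_of_nonneg (barnesLin_pos hw hx m)
      (hsub hu).1) (by fun_prop) continuousAt_const rfl
  · refine Eventually.of_forall fun u hu ↦ ?_
    have hu' := hsub hu
    have hL := barnesLin_pos hw hx m
    rw [norm_mul, norm_ofReal_cpow_neg (by linarith [hu'.1]), Complex.norm_real,
      Real.norm_of_nonneg (by linarith [hu'.2])]
    refine mul_le_mul (by linarith [hu'.1]) ?_ (Real.rpow_nonneg (by linarith [hu'.1]) _) hb
    exact Real.rpow_le_rpow_of_nonpos hL (by linarith [hu'.1]) (by linarith)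
  · exact Eventually.of_forall fun _ _ ↦ hbd
  · exact intervalIntegrable_const
  · refine Eventually.of_forall fun u hu ↦ ?_
    have h := hasSum_barnesSeries hw hs (show 0 < x + u by linarith [(hsub hu).1])
    simp only [barnesLin_add] at h
    exact h.mul_left _

/-- Along coordinate 0 the differences telescope to their first term, because the terms tend to 0.
Only the differences are assumed summable: the recursion uses this at `s - 1`, where the full series
may diverge. -/
theorem barnesSeries_tail_eq_of_hasSum {r : ℕ} {w : Fin (r + 1) → ℝ} (hw : ∀ j, 0 < w j) {s T : ℂ}
    {x : ℝ} (hs : (r : ℝ) < s.re) (hx : 0 < x)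
    (hT : HasSum (fun m : Fin (r + 1) → ℕ ↦ (barnesLin w x m : ℂ) ^ (-s) -
      ((barnesLin w x m + w 0 : ℝ) : ℂ) ^ (-s)) T) :
    barnesSeries (Fin.tail w) s x = T := by
  have hrn : (0 : ℝ) ≤ r := Nat.cast_nonneg r
  have hw' : ∀ j, 0 < Fin.tail w j := fun j ↦ hw _
  rw [← (finSuccFunEquiv r).hasSum_iff] at hT
  have h2 : ∀ m : Fin r → ℕ, HasSum (fun n : ℕ ↦ ((fun m : Fin (r + 1) → ℕ ↦
      (barnesLin w x m : ℂ) ^ (-s) - ((barnesLin w x m + w 0 : ℝ) : ℂ) ^ (-s)) ∘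
        finSuccFunEquiv r) (m, n)) ((barnesLin (Fin.tail w) x m : ℂ) ^ (-s)) := by
    intro m
    have hsum := hT.summable.prod_factor m
    have hL := barnesLin_pos hw' hx m
    refine (hsum.hasSum_iff_tendsto_nat).2 ?_
    have htel : ∀ N : ℕ, ∑ n ∈ Finset.range N, ((fun m : Fin (r + 1) → ℕ ↦
      (barnesLin w x m : ℂ) ^ (-s) - ((barnesLin w x m + w 0 : ℝ) : ℂ) ^ (-s)) ∘
        finSuccFunEquiv r) (m, n) = (barnesLin (Fin.tail w) x m : ℂ) ^ (-s) -
          ((barnesLin (Fin.tail w) x m + N * w 0 : ℝ) : ℂ) ^ (-s) := by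
      intro N
      simp only [Function.comp, barnesLin_finSuccFunEquiv]
      have := Finset.sum_range_sub'
        (fun n : ℕ ↦ ((barnesLin (Fin.tail w) x m + n * w 0 : ℝ) : ℂ) ^ (-s)) N
      simp only [Nat.cast_zero, zero_mul, add_zero] at this
      rw [← this]
      refine Finset.sum_congr rfl fun n _ ↦ ?_
      rw [show barnesLin (Fin.tail w) x m + (n : ℝ) * w 0 + w 0 =
        barnesLin (Fin.tail w) x m + ((n + 1 : ℕ) : ℝ) * w 0 by push_cast; ring]
    simp only [htel]
    have hlim : Tendsto (fun N : ℕ ↦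
        ((barnesLin (Fin.tail w) x m + N * w 0 : ℝ) : ℂ) ^ (-s)) atTop (𝓝 0) := by
      rw [tendsto_zero_iff_norm_tendsto_zero]
      have hpos : ∀ N : ℕ, 0 < barnesLin (Fin.tail w) x m + N * w 0 := fun N ↦ by
        have := hw 0; positivity
      simp only [norm_ofReal_cpow_neg (hpos _)]
      refine (tendsto_rpow_neg_atTop (y := s.re) (by linarith)).comp ?_
      exact tendsto_atTop_add_const_left _ _
        (tendsto_natCast_atTop_atTop.atTop_mul_const (hw 0))
    simpa using hlim.const_sub ((barnesLin (Fin.tail w) x m : ℂ) ^ (-s))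
  exact (hasSum_barnesSeries hw' hs hx).unique (hT.prod_fiberwise h2)

/-- Solved for the series at `s`, this involves one variable fewer, or the same series at `s + 1`;
that is the source of the continuation. -/
theorem barnesSeries_recursion {r : ℕ} {w : Fin (r + 1) → ℝ} (hw : ∀ j, 0 < w j) {s : ℂ} {x : ℝ}
    (hs : (r : ℝ) + 1 < s.re) (hx : 0 < x) :
    barnesSeries (Fin.tail w) (s - 1) x = (s - 1) * (w 0 * barnesSeries w s x -
      s * ∫ u in (0 : ℝ)..w 0, ((w 0 - u : ℝ) : ℂ) * barnesSeries w (s + 1) (x + u)) := by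
  refine barnesSeries_tail_eq_of_hasSum hw (by simp; linarith) hx ?_
  simp only [cpow_sub_cpow_add_eq (barnesLin_pos hw hx _) (hw 0).le]
  refine HasSum.mul_left _ (HasSum.sub (HasSum.mul_left _ ?_) (HasSum.mul_left _ ?_))
  · exact hasSum_barnesSeries hw (by push_cast; linarith) hx
  · exact hasSum_integral_barnesSeries hw (by push_cast; simp; linarith) hx (hw 0).le

theorem barnesSeries_sub_shift {r : ℕ} {w : Fin (r + 1) → ℝ} (hw : ∀ j, 0 < w j) {s : ℂ} {x : ℝ}
    (hs : (r : ℝ) + 1 < s.re) (hx : 0 < x) :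
    barnesSeries (Fin.tail w) s x = barnesSeries w s x - barnesSeries w s (x + w 0) := by
  refine barnesSeries_tail_eq_of_hasSum hw (by linarith) hx (HasSum.sub ?_ ?_)
  · exact hasSum_barnesSeries hw (by push_cast; linarith) hx
  · have h := hasSum_barnesSeries hw (s := s) (by push_cast; linarith) (add_pos hx (hw 0))
    simpa only [barnesLin_add] using h

/-! ### Continuation to the left by the recursion -/

/-- The polynomial `(s - 1) ⋯ (s - r)`. -/
def barnesDenom (r : ℕ) (s : ℂ) : ℂ := ∏ k ∈ Finset.range r, (s - (k + 1))

theorem barnesDenom_succ (r : ℕ) (s : ℂ) :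
    barnesDenom (r + 1) s = barnesDenom r s * (s - (r + 1)) := by
  simp [barnesDenom, Finset.prod_range_succ]

theorem barnesDenom_succ' (r : ℕ) (s : ℂ) :
    barnesDenom (r + 1) s = (s - 1) * barnesDenom r (s - 1) := by
  simp only [barnesDenom, Finset.prod_range_succ']
  rw [mul_comm]
  congr 1
  · simp
  · refine Finset.prod_congr rfl fun k _ ↦ ?_
    push_cast; ring

theorem differentiable_barnesDenom (r : ℕ) : Differentiable ℂ (barnesDenom r) := by
  unfold barnesDenom; fun_prop

theorem barnesDenom_ne_zero {r : ℕ} {s : ℂ} (hs : ∀ k : ℕ, 1 ≤ k → k ≤ r → s ≠ (k : ℂ)) :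
    barnesDenom r s ≠ 0 := by
  refine Finset.prod_ne_zero_iff.2 fun k hk h ↦ hs (k + 1) (by omega) ?_ ?_
  · have := Finset.mem_range.1 hk; omega
  · push_cast; linear_combination h

theorem barnesDenom_ne_zero_of_lt_re {r : ℕ} {s : ℂ} (hs : (r : ℝ) < s.re) :
    barnesDenom r s ≠ 0 := by
  refine barnesDenom_ne_zero fun k _ hk h ↦ ?_
  rw [h, Complex.natCast_re] at hs
  exact absurd (Nat.cast_lt.1 hs) (by omega)

/-- `E s x` is the entire function `(s - 1) ⋯ (s - r) ζ_r(s, x, w)`, jointly continuous in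
`s` and `x`. -/
structure IsBarnesNumerator {r : ℕ} (w : Fin r → ℝ) (E : ℂ → ℝ → ℂ) : Prop where
  continuousOn : ContinuousOn (fun q : ℂ × ℝ ↦ E q.1 q.2) (univ ×ˢ Ioi 0)
  differentiable : ∀ x, 0 < x → Differentiable ℂ (fun s ↦ E s x)
  eq_series : ∀ x, 0 < x → ∀ s : ℂ, (r : ℝ) < s.re → E s x = barnesDenom r s * barnesSeries w s x

/-- The successive extensions of `barnesDenom (r + 1) s * barnesSeries w s x` to the left; `E` is
the numerator for the tail of `w`. -/
noncomputable def barnesExtension {r : ℕ} (w : Fin (r + 1) → ℝ) (E : ℂ → ℝ → ℂ) : ℕ → ℂ → ℝ → ℂ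
  | 0 => fun s x ↦ barnesDenom (r + 1) s * barnesSeries w s x
  | n + 1 => fun s x ↦ (w 0 : ℂ)⁻¹ * (E (s - 1) x + (s - (r + 1)) *
      ∫ u in (0 : ℝ)..w 0, ((w 0 - u : ℝ) : ℂ) * barnesExtension w E n (s + 1) (x + u))

theorem barnesExtension_continuousOn {r : ℕ} {w : Fin (r + 1) → ℝ} (hw : ∀ j, 0 < w j)
    {E : ℂ → ℝ → ℂ} (hE : IsBarnesNumerator (Fin.tail w) E) (n : ℕ) :
    ContinuousOn (fun q : ℂ × ℝ ↦ barnesExtension w E n q.1 q.2)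
      ({s | (r : ℝ) + 1 - n < s.re} ×ˢ Ioi 0) := by
  induction n with
  | zero =>
    have h := continuousOn_barnesSeries hw
    simp only [Nat.cast_add, Nat.cast_one] at h
    simp only [barnesExtension, Nat.cast_zero, sub_zero]
    exact ((differentiable_barnesDenom (r + 1)).continuous.comp continuous_fst).continuousOn.mul h
  | succ n ih =>
    simp only [barnesExtension]
    refine continuousOn_const.mul (ContinuousOn.add ?_ (ContinuousOn.mul (by fun_prop) ?_))
    · exact hE.continuousOn.comp (f := fun q : ℂ × ℝ ↦ (q.1 - 1, q.2)) (by fun_prop)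
        (fun q hq ↦ ⟨mem_univ _, hq.2⟩)
    · refine (continuousOn_shift_integral (hw 0).le ih).mono (prod_mono (fun s hs ↦ ?_) Subset.rfl)
      simp only [mem_ofPred_eq, Complex.add_re, Complex.one_re] at hs ⊢
      push_cast at hs
      linarith

theorem barnesExtension_differentiableOn {r : ℕ} {w : Fin (r + 1) → ℝ} (hw : ∀ j, 0 < w j)
    {E : ℂ → ℝ → ℂ} (hE : IsBarnesNumerator (Fin.tail w) E) (n : ℕ) : ∀ {x : ℝ}, 0 < x →
    DifferentiableOn ℂ (fun s ↦ barnesExtension w E n s x) {s | (r : ℝ) + 1 - n < s.re} := by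
  induction n with
  | zero =>
    intro x hx
    have h := differentiableOn_barnesSeries hw hx
    simp only [Nat.cast_add, Nat.cast_one] at h
    simp only [barnesExtension, Nat.cast_zero, sub_zero]
    exact (differentiable_barnesDenom (r + 1)).differentiableOn.mul h
  | succ n ih =>
    intro x hx
    have hopen : ∀ c : ℝ, IsOpen {s : ℂ | c < s.re} := fun c ↦
      isOpen_lt continuous_const Complex.continuous_re
    simp only [barnesExtension]
    have hmaps : ∀ s ∈ {s : ℂ | (r : ℝ) + 1 - (n + 1 : ℕ) < s.re},
        s + 1 ∈ {s : ℂ | (r : ℝ) + 1 - n < s.re} := by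
      intro s hs
      simp only [mem_ofPred_eq, Complex.add_re, Complex.one_re] at hs ⊢
      push_cast at hs
      linarith
    refine (DifferentiableOn.add ?_ (DifferentiableOn.mul (by fun_prop) ?_)).const_mul _
    · exact ((hE.differentiable x hx).comp (differentiable_id.sub_const 1)).differentiableOn
    · refine differentiableOn_intervalIntegral_of_continuousOn (hopen _) (hw 0).le ?_ ?_
      · refine ContinuousOn.mul (by fun_prop) ?_
        exact (barnesExtension_continuousOn hw hE n).comp
          (f := fun q : ℂ × ℝ ↦ (q.1 + 1, x + q.2)) (by fun_prop)
          (fun q hq ↦ ⟨hmaps _ hq.1, add_pos_of_pos_of_nonneg hx hq.2.1⟩)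
      · intro u hu
        refine DifferentiableOn.const_mul ?_ _
        exact (ih (add_pos_of_pos_of_nonneg hx hu.1)).comp (f := fun s : ℂ ↦ s + 1)
          (by fun_prop) hmaps

/-- The case `n = 0` is the recursion for the series with the denominators cleared; at higher levels
the integrands already agree at `s + 1`. -/
theorem barnesExtension_succ_eq {r : ℕ} {w : Fin (r + 1) → ℝ} (hw : ∀ j, 0 < w j)
    {E : ℂ → ℝ → ℂ} (hE : IsBarnesNumerator (Fin.tail w) E) (n : ℕ) : ∀ {x : ℝ}, 0 < x → ∀ {s : ℂ},
    (r : ℝ) + 1 - n < s.re → barnesExtension w E (n + 1) s x = barnesExtension w E n s x := by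
  have hw0 : (w 0 : ℂ) ≠ 0 := by exact_mod_cast (hw 0).ne'
  induction n with
  | zero =>
    intro x hx s hs
    simp only [Nat.cast_zero, sub_zero] at hs
    simp only [barnesExtension]
    rw [hE.eq_series x hx _ (by simp; linarith), barnesSeries_recursion hw hs hx]
    simp only [mul_left_comm _ (barnesDenom (r + 1) (s + 1)), intervalIntegral.integral_const_mul]
    have e1 := barnesDenom_succ' r s
    have e2 : barnesDenom (r + 1) (s + 1) = s * barnesDenom r s := by
      rw [barnesDenom_succ']; simp
    have e3 := barnesDenom_succ r s
    -- This identity is why the extension carries the factor `s - (r + 1)` and needs no division by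
    -- a polynomial in `s`.
    have e4 : (s - (r + 1)) * barnesDenom (r + 1) (s + 1) = s * ((s - 1) * barnesDenom r (s - 1)) := by
      rw [e2, ← e1, e3]; ring
    rw [inv_mul_eq_iff_eq_mul₀ hw0, e1]
    linear_combination (∫ u in (0 : ℝ)..w 0, ((w 0 - u : ℝ) : ℂ) *
      barnesSeries w (s + 1) (x + u)) * e4
  | succ n ih =>
    intro x hx s hs
    have hI : (∫ u in (0 : ℝ)..w 0, ((w 0 - u : ℝ) : ℂ) *
        barnesExtension w E (n + 1) (s + 1) (x + u)) =
        ∫ u in (0 : ℝ)..w 0, ((w 0 - u : ℝ) : ℂ) * barnesExtension w E n (s + 1) (x + u) := by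
      refine intervalIntegral.integral_congr fun u hu ↦ ?_
      rw [uIcc_of_le (hw 0).le] at hu
      rw [ih (add_pos_of_pos_of_nonneg hx hu.1)]
      simp only [Complex.add_re, Complex.one_re]
      push_cast at hs
      linarith
    change (w 0 : ℂ)⁻¹ * (E (s - 1) x + (s - (r + 1)) * ∫ u in (0 : ℝ)..w 0, ((w 0 - u : ℝ) : ℂ) *
        barnesExtension w E (n + 1) (s + 1) (x + u)) = _
    rw [hI, barnesExtension]

theorem barnesExtension_add_eq {r : ℕ} {w : Fin (r + 1) → ℝ} (hw : ∀ j, 0 < w j)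
    {E : ℂ → ℝ → ℂ} (hE : IsBarnesNumerator (Fin.tail w) E) (n k : ℕ) {x : ℝ} (hx : 0 < x) {s : ℂ}
    (hs : (r : ℝ) + 1 - n < s.re) :
    barnesExtension w E (n + k) s x = barnesExtension w E n s x := by
  induction k with
  | zero => rfl
  | succ k ih =>
    rw [← ih, ← add_assoc, barnesExtension_succ_eq hw hE _ hx]
    push_cast
    have : (0 : ℝ) ≤ k := Nat.cast_nonneg k
    linarith

theorem exists_isBarnesNumerator (r : ℕ) : ∀ w : Fin r → ℝ, (∀ j, 0 < w j) →
    ∃ E, IsBarnesNumerator w E := by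
  induction r with
  | zero =>
    intro w hw
    refine ⟨fun s x ↦ (x : ℂ) ^ (-s), ?_, ?_, ?_⟩
    · rintro ⟨s, x⟩ ⟨-, hx⟩
      exact (continuousAt_ofReal_cpow_neg (f := fun q : ℂ × ℝ ↦ q.2) (g := fun q : ℂ × ℝ ↦ q.1) hx
        continuousAt_snd continuousAt_fst rfl).continuousWithinAt
    · intro x hx
      exact Differentiable.const_cpow (by fun_prop) (Or.inl (by exact_mod_cast hx.ne'))
    · intro x hx s _
      simp [barnesDenom, barnesSeries, barnesLin]
  | succ r ih =>
    intro w hw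
    obtain ⟨E, hE⟩ := ih (Fin.tail w) (fun j ↦ hw _)
    -- The extra 1 makes the inequality `hNs` strict, so near `s` the glued function coincides with
    -- a single level of the extension.
    set N : ℂ → ℕ := fun s ↦ ⌈(r : ℝ) + 1 - s.re⌉₊ + 1 with hN
    have hNs : ∀ s : ℂ, (r : ℝ) + 1 - N s < s.re := fun s ↦ by
      have := Nat.le_ceil ((r : ℝ) + 1 - s.re)
      simp only [hN]; push_cast; linarith
    have heq : ∀ n : ℕ, ∀ s : ℂ, (r : ℝ) + 1 - n < s.re → ∀ x, 0 < x →
        barnesExtension w E (N s) s x = barnesExtension w E n s x := by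
      intro n s hs x hx
      rcases le_total n (N s) with h | h
      · obtain ⟨k, hk⟩ := Nat.exists_eq_add_of_le h
        rw [hk, barnesExtension_add_eq hw hE n k hx hs]
      · obtain ⟨k, hk⟩ := Nat.exists_eq_add_of_le h
        rw [hk, barnesExtension_add_eq hw hE _ k hx (hNs s)]
    have hopen : ∀ c : ℝ, IsOpen {s : ℂ | c < s.re} := fun c ↦
      isOpen_lt continuous_const Complex.continuous_re
    refine ⟨fun s x ↦ barnesExtension w E (N s) s x, ?_, ?_, ?_⟩
    · rintro ⟨s, x⟩ ⟨-, hx⟩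
      have hmem := ((hopen ((r : ℝ) + 1 - N s)).prod isOpen_Ioi).mem_nhds
        (show (s, x) ∈ _ ×ˢ Ioi (0 : ℝ) from ⟨hNs s, hx⟩)
      refine (((barnesExtension_continuousOn hw hE (N s)).continuousAt hmem).congr
        ?_).continuousWithinAt
      filter_upwards [hmem] with q hq using (heq _ _ hq.1 _ hq.2).symm
    · intro x hx s
      have hmem := (hopen ((r : ℝ) + 1 - N s)).mem_nhds (hNs s)
      refine ((barnesExtension_differentiableOn hw hE (N s) hx).differentiableAt hmem).congr_of_eventuallyEq
        ?_
      filter_upwards [hmem] with q hq using heq _ _ hq _ hx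
    · intro x hx s hs
      push_cast at hs
      have := heq 0 s (by simpa using hs) x hx
      simpa only [barnesExtension] using this

/-- Relations between numerators are proved where the series converge and transported to all `s` in
this way. -/
theorem eq_of_eqOn_halfPlane {f g : ℂ → ℂ} (hf : Differentiable ℂ f) (hg : Differentiable ℂ g)
    (c : ℝ) (h : ∀ s : ℂ, c < s.re → f s = g s) (s : ℂ) : f s = g s := by
  have hmem : {s : ℂ | c < s.re} ∈ 𝓝 ((c + 1 : ℝ) : ℂ) :=
    (isOpen_lt continuous_const Complex.continuous_re).mem_nhds (by simp)
  have := AnalyticOnNhd.eq_of_eventuallyEq (fun z _ ↦ hf.analyticAt z) (fun z _ ↦ hg.analyticAt z)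
    (z₀ := ((c + 1 : ℝ) : ℂ)) (by filter_upwards [hmem] with z hz using h z hz)
  exact congrFun this s

theorem IsBarnesNumerator.recursion {r : ℕ} {w : Fin (r + 1) → ℝ} (hw : ∀ j, 0 < w j)
    {E F : ℂ → ℝ → ℂ} (hE : IsBarnesNumerator (Fin.tail w) E) (hF : IsBarnesNumerator w F) {x : ℝ}
    (hx : 0 < x) (s : ℂ) : F s x = (w 0 : ℂ)⁻¹ * (E (s - 1) x + (s - (r + 1)) *
      ∫ u in (0 : ℝ)..w 0, ((w 0 - u : ℝ) : ℂ) * F (s + 1) (x + u)) := by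
  refine eq_of_eqOn_halfPlane (g := fun s ↦ (w 0 : ℂ)⁻¹ * (E (s - 1) x + (s - (r + 1)) *
      ∫ u in (0 : ℝ)..w 0, ((w 0 - u : ℝ) : ℂ) * F (s + 1) (x + u)))
    (hF.differentiable x hx) ?_ ((r : ℝ) + 1) ?_ s
  · refine (Differentiable.add ?_ (Differentiable.mul (by fun_prop) ?_)).const_mul _
    · exact (hE.differentiable x hx).comp (differentiable_id.sub_const 1)
    · rw [← differentiableOn_univ]
      refine differentiableOn_intervalIntegral_of_continuousOn isOpen_univ (hw 0).le ?_ ?_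
      · refine ContinuousOn.mul (by fun_prop) ?_
        exact hF.continuousOn.comp (f := fun q : ℂ × ℝ ↦ (q.1 + 1, x + q.2)) (by fun_prop)
          (fun q hq ↦ ⟨mem_univ _, add_pos_of_pos_of_nonneg hx hq.2.1⟩)
      · intro u hu
        exact (((hF.differentiable _ (add_pos_of_pos_of_nonneg hx hu.1)).comp
          (differentiable_id.add_const 1)).const_mul _).differentiableOn
  · intro s hs
    have h := barnesExtension_succ_eq hw hE 0 hx (s := s) (by simpa using hs)
    simp only [barnesExtension] at h
    rw [hF.eq_series x hx s (by push_cast; exact hs), ← h]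
    congr 3
    refine intervalIntegral.integral_congr fun u hu ↦ ?_
    rw [uIcc_of_le (hw 0).le] at hu
    rw [hF.eq_series _ (add_pos_of_pos_of_nonneg hx hu.1) _ (by push_cast; simp; linarith)]

theorem IsBarnesNumerator.sub_shift {r : ℕ} {w : Fin (r + 1) → ℝ} (hw : ∀ j, 0 < w j)
    {E F : ℂ → ℝ → ℂ} (hE : IsBarnesNumerator (Fin.tail w) E) (hF : IsBarnesNumerator w F) {x : ℝ}
    (hx : 0 < x) (s : ℂ) : F s x - F s (x + w 0) = (s - (r + 1)) * E s x := by
  have hx' := add_pos hx (hw 0)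
  refine eq_of_eqOn_halfPlane (g := fun s ↦ (s - (r + 1)) * E s x)
    ((hF.differentiable x hx).sub (hF.differentiable _ hx'))
    (Differentiable.mul (by fun_prop) (hE.differentiable x hx)) ((r : ℝ) + 1) (fun s hs ↦ ?_) s
  rw [Pi.sub_apply, hF.eq_series x hx s (by push_cast; exact hs), hF.eq_series _ hx' s (by push_cast; exact hs),
    hE.eq_series x hx s (by linarith), barnesSeries_sub_shift hw hs hx, barnesDenom_succ]
  ring

/-! ### The continued function and its two functional relations -/

/-- A choice of the entire function `(s - 1) ⋯ (s - r) ζ_r(s, x, w)`. -/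
noncomputable def barnesNumerator {r : ℕ} (w : Fin r → ℝ) : ℂ → ℝ → ℂ :=
  Classical.epsilon (IsBarnesNumerator w)

theorem isBarnesNumerator_barnesNumerator {r : ℕ} {w : Fin r → ℝ} (hw : ∀ j, 0 < w j) :
    IsBarnesNumerator w (barnesNumerator w) :=
  Classical.epsilon_spec (exists_isBarnesNumerator r w hw)

/-- The continued Barnes zeta function, as a function of `s` and of the shift `x`. -/
noncomputable def barnesCont {r : ℕ} (w : Fin r → ℝ) (s : ℂ) (x : ℝ) : ℂ :=
  barnesNumerator w s x / barnesDenom r s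

theorem barnesDenom_ne_zero_of_im {r : ℕ} {s : ℂ} (hs : s.im ≠ 0) : barnesDenom r s ≠ 0 :=
  barnesDenom_ne_zero fun k _ _ h ↦ hs (by rw [h, Complex.natCast_im])

theorem barnesCont_eq_series {r : ℕ} {w : Fin r → ℝ} (hw : ∀ j, 0 < w j) {s : ℂ} {x : ℝ}
    (hs : (r : ℝ) < s.re) (hx : 0 < x) : barnesCont w s x = barnesSeries w s x := by
  rw [barnesCont, (isBarnesNumerator_barnesNumerator hw).eq_series x hx s hs,
    mul_div_cancel_left₀ _ (barnesDenom_ne_zero_of_lt_re hs)]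

theorem barnesCont_zero (w : Fin 0 → ℝ) {x : ℝ} (hx : 0 < x) (s : ℂ) :
    barnesCont w s x = (x : ℂ) ^ (-s) := by
  have hE := isBarnesNumerator_barnesNumerator (w := w) (fun j ↦ j.elim0)
  have h : barnesNumerator w s x = (x : ℂ) ^ (-s) := by
    refine eq_of_eqOn_halfPlane (g := fun s ↦ (x : ℂ) ^ (-s)) (hE.differentiable x hx)
      (Differentiable.const_cpow (by fun_prop) (Or.inl (by exact_mod_cast hx.ne'))) 0
      (fun s hs ↦ ?_) s
    rw [hE.eq_series x hx s (by simpa using hs)]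
    simp [barnesDenom, barnesSeries, barnesLin]
  simp [barnesCont, barnesDenom, h]

theorem barnesCont_sub_shift {r : ℕ} {w : Fin (r + 1) → ℝ} (hw : ∀ j, 0 < w j) {s : ℂ}
    (hs : s.im ≠ 0) {x : ℝ} (hx : 0 < x) :
    barnesCont w s x - barnesCont w s (x + w 0) = barnesCont (Fin.tail w) s x := by
  have h := IsBarnesNumerator.sub_shift hw
    (isBarnesNumerator_barnesNumerator (w := Fin.tail w) fun j ↦ hw _)
    (isBarnesNumerator_barnesNumerator hw) hx s
  have h1 := barnesDenom_ne_zero_of_im (r := r + 1) hs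
  have h2 := barnesDenom_ne_zero_of_im (r := r) hs
  rw [barnesCont, barnesCont, barnesCont, ← sub_div, h, div_eq_div_iff h1 h2, barnesDenom_succ]
  ring

theorem barnesCont_recursion {r : ℕ} {w : Fin (r + 1) → ℝ} (hw : ∀ j, 0 < w j) {s : ℂ}
    (hs : s.im ≠ 0) {x : ℝ} (hx : 0 < x) :
    barnesCont w s x = (w 0 : ℂ)⁻¹ * (barnesCont (Fin.tail w) (s - 1) x / (s - 1) +
      s * ∫ u in (0 : ℝ)..w 0, ((w 0 - u : ℝ) : ℂ) * barnesCont w (s + 1) (x + u)) := by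
  have h := IsBarnesNumerator.recursion hw
    (isBarnesNumerator_barnesNumerator (w := Fin.tail w) fun j ↦ hw _)
    (isBarnesNumerator_barnesNumerator hw) hx s
  have h1 := barnesDenom_ne_zero_of_im (r := r + 1) hs
  have h2 := barnesDenom_ne_zero_of_im (r := r + 1) (s := s + 1) (by simpa using hs)
  have h3 := barnesDenom_ne_zero_of_im (r := r) (s := s - 1) (by simpa using hs)
  have e1 := barnesDenom_succ' r s
  have e2 : barnesDenom (r + 1) (s + 1) = s * barnesDenom r s := by
    rw [barnesDenom_succ']; simp
  have e3 := barnesDenom_succ r s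
  have h4 : s - 1 ≠ 0 := fun h0 ↦ hs (by rw [sub_eq_zero.1 h0]; simp)
  simp only [barnesCont]
  rw [h]
  simp only [← mul_div_assoc, intervalIntegral.integral_div]
  rw [mul_div_assoc, add_div]
  congr 2
  · rw [e1, div_div, mul_comm (s - 1)]
  · rw [div_eq_div_iff h1 h2, e2, e3]
    ring

/-! ### Size of the continued function when the shift is large compared with `|s|` -/

/-- For a positive exponent, `(1 + u/x)^e' ≤ exp (e' u / x) ≤ exp (1/2) < 2`. A negative exponent
only helps. -/
theorem add_rpow_le_two_mul {x u b e e' : ℝ} (hx : 0 < x) (hu : 0 ≤ u) (hub : u ≤ b)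
    (hee : e' ≤ e) (h : 2 * b * e ≤ x) : (x + u) ^ e' ≤ 2 * x ^ e' := by
  have hxe := Real.rpow_pos_of_pos hx e'
  rcases le_total e' 0 with h0 | h0
  · have := Real.rpow_le_rpow_of_nonpos hx (show x ≤ x + u by linarith) h0
    linarith
  · have e1 : x + u = x * (1 + u / x) := by field_simp
    rw [e1, Real.mul_rpow hx.le (by positivity), mul_comm]
    refine mul_le_mul_of_nonneg_right ?_ hxe.le
    have h1 : 1 + u / x ≤ Real.exp (u / x) := by linarith [Real.add_one_le_exp (u / x)]
    have h2 : u / x * e' ≤ 1 / 2 := by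
      rw [div_mul_eq_mul_div, div_le_iff₀ hx]
      have : u * e' ≤ b * e := mul_le_mul hub hee h0 (hu.trans hub)
      linarith
    calc (1 + u / x) ^ e' ≤ Real.exp (u / x) ^ e' :=
          Real.rpow_le_rpow (by positivity) h1 h0
      _ = Real.exp (u / x * e') := (Real.exp_mul _ _).symm
      _ ≤ Real.exp (Real.log 2) := by
          refine Real.exp_le_exp.2 (h2.trans ?_)
          have := Real.log_two_gt_d9; norm_num at this ⊢; linarith
      _ = 2 := Real.exp_log two_pos

/-- Pulling the excess power of `x ≤ barnesLin w x m` out of each term makes `A` independent of `s`,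
which matters because the iteration starts arbitrarily far to the right. -/
theorem norm_barnesSeries_le {r : ℕ} {w : Fin r → ℝ} (hw : ∀ j, 0 < w j) : ∃ A : ℝ, 0 ≤ A ∧
    ∀ (s : ℂ) (x : ℝ), (r : ℝ) + 1 ≤ s.re → 1 ≤ x →
      ‖barnesSeries w s x‖ ≤ A * x ^ ((r : ℝ) - s.re) := by
  obtain ⟨A, hA0, hA⟩ := barnes_summable_bound r w hw (r + 1) (by linarith) 1 one_pos
  refine ⟨A, hA0, fun s x hs hx ↦ ?_⟩
  have hx0 : 0 < x := by linarith
  obtain ⟨h1, h2⟩ := hA x hx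
  have hle : ∀ m, ‖(barnesLin w x m : ℂ) ^ (-s)‖ ≤
      x ^ (-(s.re - (r + 1))) * barnesLin w x m ^ (-((r : ℝ) + 1)) := fun m ↦ by
    have hL := barnesLin_pos hw hx0 m
    rw [norm_ofReal_cpow_neg hL, show -s.re = -(s.re - (r + 1)) + -((r : ℝ) + 1) by ring,
      Real.rpow_add hL]
    refine mul_le_mul_of_nonneg_right ?_ (Real.rpow_nonneg hL.le _)
    exact Real.rpow_le_rpow_of_nonpos hx0 (le_barnesLin hw x m) (by linarith)
  refine (tsum_of_norm_bounded (h1.hasSum.mul_left _) hle).trans ?_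
  calc x ^ (-(s.re - (r + 1))) * ∑' m, barnesLin w x m ^ (-((r : ℝ) + 1))
      ≤ x ^ (-(s.re - (r + 1))) * (A * x ^ ((r : ℝ) - (r + 1))) := by gcongr
    _ = A * x ^ ((r : ℝ) - s.re) := by
      rw [mul_left_comm, ← Real.rpow_add hx0]; congr 2; ring

/-- Each use of the recursion adds a tail term of relative size `1 / s.im` and multiplies the
earlier bound by at most `1/4`. After `K` steps the series bound has decayed to `A / 2 ^ K`, while
the tail terms add up to a convergent geometric sum. -/
theorem norm_barnesCont_iterate {r : ℕ} {w : Fin (r + 1) → ℝ} (hw : ∀ j, 0 < w j) {σ₀ C₁ X' : ℝ}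
    (hC₁ : 0 ≤ C₁) (hX' : 0 ≤ X')
    (htail : ∀ (s : ℂ) (x : ℝ), σ₀ - 1 ≤ s.re → 1 ≤ s.im → X' * ‖s‖ ≤ x → 0 < x →
      ‖barnesCont (Fin.tail w) s x‖ ≤ C₁ * x ^ ((r : ℝ) - s.re)) :
    ∃ A : ℝ, 0 ≤ A ∧ ∃ X : ℝ, 1 ≤ X ∧ ∀ (K : ℕ) (s : ℂ) (x : ℝ), σ₀ ≤ s.re → 1 ≤ s.im →
      (r : ℝ) + 2 ≤ s.re + K → X * (‖s‖ + K) ≤ x →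
      ‖barnesCont w s x‖ ≤ (2 * ((w 0)⁻¹ * C₁) / s.im + A / 2 ^ K) * x ^ ((r : ℝ) + 1 - s.re) := by
  obtain ⟨A, hA0, hA⟩ := norm_barnesSeries_le hw
  have hw0 := hw 0
  set e : ℝ := max ((r : ℝ) - σ₀) 0 with he
  have he0 : 0 ≤ e := le_max_right _ _
  refine ⟨A, hA0, 1 + 2 * X' + 8 * w 0 + 2 * w 0 * e, by nlinarith [mul_nonneg hw0.le he0], ?_⟩
  -- The summands ensure, in order: `x ≥ 1`; the tail bound applies at `s - 1`, since `‖s - 1‖ ≤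
  -- 2‖s‖`; the integral term contracts by `1/4`; and shifting `x` by at most `w 0` costs a factor
  -- 2.
  set X : ℝ := 1 + 2 * X' + 8 * w 0 + 2 * w 0 * e with hX
  have hwe : 0 ≤ w 0 * e := mul_nonneg hw0.le he0
  intro K
  induction K with
  | zero =>
    intro s x hσ ht hK hx
    simp only [Nat.cast_zero, add_zero] at hK hx
    have hns : 1 ≤ ‖s‖ := ht.trans ((le_abs_self _).trans (Complex.abs_im_le_norm s))
    have hx1 : 1 ≤ x := by nlinarith
    rw [barnesCont_eq_series hw (by push_cast; linarith) (by linarith)]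
    have h := hA s x (by push_cast; linarith) hx1
    push_cast at h
    refine h.trans (mul_le_mul_of_nonneg_right ?_ (Real.rpow_nonneg (by linarith) _))
    have : 0 ≤ 2 * ((w 0)⁻¹ * C₁) / s.im := by positivity
    simpa using this
  | succ K ih =>
    intro s x hσ ht hK hx
    push_cast at hK hx
    have hns : 1 ≤ ‖s‖ := ht.trans ((le_abs_self _).trans (Complex.abs_im_le_norm s))
    have hK0 : (0 : ℝ) ≤ K := Nat.cast_nonneg K
    have hXs : X * ‖s‖ ≤ x := by nlinarith
    have hx0 : 0 < x := by nlinarith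
    have ht0 : s.im ≠ 0 := by linarith
    have hs1 : s.im ≤ ‖s - 1‖ := by
      have := (le_abs_self _).trans (Complex.abs_im_le_norm (s - 1)); simpa using this
    have hs1' : ‖s - 1‖ ≤ 2 * ‖s‖ := by
      have := norm_sub_le s 1; rw [norm_one] at this; linarith
    have hs2 : ‖s + 1‖ ≤ ‖s‖ + 1 := by
      have := norm_add_le s 1; rwa [norm_one] at this
    set H : ℝ := 2 * ((w 0)⁻¹ * C₁) / s.im + A / 2 ^ K with hH
    have hH0 : 0 ≤ H := by positivity
    have hxe := Real.rpow_pos_of_pos hx0 ((r : ℝ) - s.re)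
    have hxe' : x ^ ((r : ℝ) + 1 - s.re) = x ^ ((r : ℝ) - s.re) * x := by
      rw [← Real.rpow_add_one hx0.ne']; congr 1; ring
    have hint : ‖∫ u in (0 : ℝ)..w 0, ((w 0 - u : ℝ) : ℂ) * barnesCont w (s + 1) (x + u)‖ ≤
        (w 0 * (H * (2 * x ^ ((r : ℝ) - s.re)))) * |w 0 - 0| := by
      refine intervalIntegral.norm_integral_le_of_norm_le_const fun u hu ↦ ?_
      rw [uIoc_of_le hw0.le] at hu
      rw [norm_mul, Complex.norm_real, Real.norm_of_nonneg (by linarith [hu.2])]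
      refine mul_le_mul (by linarith [hu.1]) ?_ (norm_nonneg _) hw0.le
      -- The side condition survives the step: `‖s + 1‖ + K ≤ ‖s‖ + (K + 1)`.
      have h := ih (s + 1) (x + u) (by simp; linarith) (by simpa using ht)
        (by simp; linarith) (by nlinarith [hu.1])
      simp only [Complex.add_im, Complex.one_im, add_zero, Complex.add_re, Complex.one_re] at h
      refine h.trans (mul_le_mul_of_nonneg_left ?_ hH0)
      rw [show (r : ℝ) + 1 - (s.re + 1) = r - s.re by ring]
      refine add_rpow_le_two_mul (e := e) hx0 hu.1.le hu.2
        ((by linarith : (r : ℝ) - s.re ≤ r - σ₀).trans (le_max_left _ _)) ?_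
      nlinarith
    have h1 := htail (s - 1) x (by simp; linarith) (by simpa using ht) (by nlinarith) hx0
    rw [show (r : ℝ) - (s - 1).re = r + 1 - s.re by simp; ring] at h1
    rw [barnesCont_recursion hw ht0 hx0, norm_mul, norm_inv, Complex.norm_real,
      Real.norm_of_nonneg hw0.le]
    have h2 : ‖barnesCont (Fin.tail w) (s - 1) x / (s - 1)‖ ≤
        C₁ * x ^ ((r : ℝ) + 1 - s.re) / s.im := by
      rw [norm_div]
      gcongr
    have h3 : ‖s * ∫ u in (0 : ℝ)..w 0, ((w 0 - u : ℝ) : ℂ) * barnesCont w (s + 1) (x + u)‖ ≤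
        w 0 * (1 / 4 * H * x ^ ((r : ℝ) + 1 - s.re)) := by
      rw [norm_mul]
      refine (mul_le_mul_of_nonneg_left hint (norm_nonneg s)).trans ?_
      rw [sub_zero, abs_of_pos hw0, hxe']
      have h8 : 8 * w 0 * ‖s‖ ≤ x := by nlinarith
      have h9 : 0 ≤ w 0 * H * x ^ ((r : ℝ) - s.re) := by positivity
      nlinarith
    have h4 := (norm_add_le _ _).trans (add_le_add h2 h3)
    refine (mul_le_mul_of_nonneg_left h4 (inv_nonneg.2 hw0.le)).trans ?_
    rw [mul_add, ← mul_assoc _ (w 0), inv_mul_cancel₀ hw0.ne', one_mul, pow_succ]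
    have hP := Real.rpow_pos_of_pos hx0 ((r : ℝ) + 1 - s.re)
    have e1 : (w 0)⁻¹ * (C₁ * x ^ ((r : ℝ) + 1 - s.re) / s.im) =
        ((w 0)⁻¹ * C₁ / s.im) * x ^ ((r : ℝ) + 1 - s.re) := by ring
    rw [e1, ← add_mul]
    refine mul_le_mul_of_nonneg_right ?_ hP.le
    have q1 : 0 ≤ (w 0)⁻¹ * C₁ / s.im := by positivity
    have q2 : 0 ≤ A / 2 ^ K := by positivity
    have q3 : A / (2 ^ K * 2) = A / 2 ^ K / 2 := by rw [div_div]
    have q4 : 2 * ((w 0)⁻¹ * C₁) / s.im = 2 * ((w 0)⁻¹ * C₁ / s.im) := mul_div_assoc _ _ _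
    rw [q3, hH, q4]
    linarith

/-- Taking about `s.im` iterations makes `A / 2 ^ K` at most `A / s.im`, while `‖s‖ + K` stays
comparable with `‖s‖`. -/
theorem norm_barnesCont_succ_of_tail {r : ℕ} {w : Fin (r + 1) → ℝ} (hw : ∀ j, 0 < w j)
    {σ₀ C₁ X' : ℝ} (hC₁ : 0 ≤ C₁) (hX' : 0 ≤ X')
    (htail : ∀ (s : ℂ) (x : ℝ), σ₀ - 1 ≤ s.re → 1 ≤ s.im → X' * ‖s‖ ≤ x → 0 < x →
      ‖barnesCont (Fin.tail w) s x‖ ≤ C₁ * x ^ ((r : ℝ) - s.re)) :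
    ∃ C : ℝ, 0 ≤ C ∧ ∃ X : ℝ, 1 ≤ X ∧ ∀ (s : ℂ) (x : ℝ), σ₀ ≤ s.re → 1 ≤ s.im → X * ‖s‖ ≤ x →
      ‖barnesCont w s x‖ ≤ C * x ^ ((r : ℝ) + 1 - s.re) / s.im := by
  obtain ⟨A, hA0, X, hX1, h⟩ := norm_barnesCont_iterate hw hC₁ hX' htail
  have hw0 := hw 0
  -- These extra steps bring `s` into the range where the series bound starts the iteration.
  set k := ⌈(r : ℝ) + 2 - σ₀⌉₊ with hk
  have hk0 : (0 : ℝ) ≤ k := Nat.cast_nonneg k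
  refine ⟨2 * ((w 0)⁻¹ * C₁) + A, by positivity, X * (3 + k), by nlinarith, ?_⟩
  intro s x hσ ht hx
  have hns : s.im ≤ ‖s‖ := (le_abs_self _).trans (Complex.abs_im_le_norm s)
  have hc1 := Nat.le_ceil s.im
  have hc2 := (Nat.ceil_lt_add_one (show 0 ≤ s.im by linarith)).le
  have hk1 := Nat.le_ceil ((r : ℝ) + 2 - σ₀)
  have h0 := h (⌈s.im⌉₊ + k) s x hσ ht (by push_cast; linarith) (by
    push_cast
    refine le_trans ?_ hx
    rw [mul_assoc]
    refine mul_le_mul_of_nonneg_left ?_ (by linarith)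
    nlinarith)
  have hx0 : 0 < x := by
    refine lt_of_lt_of_le ?_ hx
    have : 0 < ‖s‖ := by linarith
    positivity
  have h2 : s.im ≤ 2 ^ (⌈s.im⌉₊ + k) := by
    have h3 : ((⌈s.im⌉₊ + k : ℕ) : ℝ) < 2 ^ (⌈s.im⌉₊ + k) := by
      exact_mod_cast Nat.lt_two_pow_self
    push_cast at h3
    linarith
  refine h0.trans ?_
  rw [mul_div_right_comm (2 * ((w 0)⁻¹ * C₁) + A), add_div]
  refine mul_le_mul_of_nonneg_right ?_ (Real.rpow_nonneg hx0.le _)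
  gcongr

/-- The saving `1 / s.im` is false for `r = 0`, so the induction drops it; `norm_barnesCont_succ_le`
recovers it with one further step. -/
theorem norm_barnesCont_le (r : ℕ) : ∀ (w : Fin r → ℝ), (∀ j, 0 < w j) → ∀ σ₀ : ℝ,
    ∃ C : ℝ, 0 ≤ C ∧ ∃ X : ℝ, 0 ≤ X ∧ ∀ (s : ℂ) (x : ℝ), σ₀ ≤ s.re → 1 ≤ s.im → X * ‖s‖ ≤ x →
      0 < x → ‖barnesCont w s x‖ ≤ C * x ^ ((r : ℝ) - s.re) := by
  induction r with
  | zero =>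
    intro w hw σ₀
    refine ⟨1, zero_le_one, 0, le_rfl, fun s x _ _ _ hx ↦ ?_⟩
    rw [barnesCont_zero w hx, norm_ofReal_cpow_neg hx]
    simp
  | succ r ih =>
    intro w hw σ₀
    obtain ⟨C₁, hC₁, X', hX', htail⟩ := ih (Fin.tail w) (fun j ↦ hw _) (σ₀ - 1)
    obtain ⟨C, hC, X, hX, h⟩ := norm_barnesCont_succ_of_tail hw hC₁ hX' htail
    refine ⟨C, hC, X, by linarith, fun s x hσ ht hx hx0 ↦ (h s x hσ ht hx).trans ?_⟩
    push_cast
    exact div_le_self (mul_nonneg hC (Real.rpow_nonneg hx0.le _)) ht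

theorem norm_barnesCont_succ_le {r : ℕ} {w : Fin (r + 1) → ℝ} (hw : ∀ j, 0 < w j) (σ₀ : ℝ) :
    ∃ C : ℝ, 0 ≤ C ∧ ∃ X : ℝ, 1 ≤ X ∧ ∀ (s : ℂ) (x : ℝ), σ₀ ≤ s.re → 1 ≤ s.im → X * ‖s‖ ≤ x →
      ‖barnesCont w s x‖ ≤ C * x ^ ((r : ℝ) + 1 - s.re) / s.im := by
  obtain ⟨C₁, hC₁, X', hX', htail⟩ := norm_barnesCont_le r (Fin.tail w) (fun j ↦ hw _) (σ₀ - 1)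
  exact norm_barnesCont_succ_of_tail hw hC₁ hX' htail

/-! ### Approximation by finite sums over boxes -/

/-- The part of the Barnes zeta series over the box `[0, N)^r`. -/
noncomputable def barnesBoxSum {r : ℕ} (w : Fin r → ℝ) (N : ℕ) (s : ℂ) (x : ℝ) : ℂ :=
  ∑ m : Fin r → Fin N, (barnesLin w x (fun j ↦ (m j : ℕ)) : ℂ) ^ (-s)

theorem barnesBoxSum_succ {r : ℕ} (w : Fin (r + 1) → ℝ) (N : ℕ) (s : ℂ) (x : ℝ) :
    barnesBoxSum w N s x = ∑ m : Fin r → Fin N, ∑ n ∈ Finset.range N,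
      ((barnesLin (Fin.tail w) x (fun j ↦ (m j : ℕ)) + n * w 0 : ℝ) : ℂ) ^ (-s) := by
  simp only [barnesBoxSum]
  rw [← (Fin.consEquiv (fun _ ↦ Fin N)).sum_comp, Fintype.sum_prod_type, Finset.sum_comm]
  refine Finset.sum_congr rfl fun m _ ↦ ?_
  rw [← Fin.sum_univ_eq_sum_range
    (fun n ↦ ((barnesLin (Fin.tail w) x (fun j ↦ (m j : ℕ)) + n * w 0 : ℝ) : ℂ) ^ (-s)) N]
  refine Finset.sum_congr rfl fun n _ ↦ ?_
  rw [← barnesLin_cons]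
  congr 3
  funext j
  refine Fin.cases ?_ (fun i ↦ ?_) j <;> simp [Fin.consEquiv]

theorem barnesBoxSum_succ' {r : ℕ} (w : Fin (r + 1) → ℝ) (N : ℕ) (s : ℂ) (x : ℝ) :
    barnesBoxSum w N s x = ∑ n ∈ Finset.range N, barnesBoxSum (Fin.tail w) N s (x + n * w 0) := by
  rw [barnesBoxSum_succ, Finset.sum_comm]
  simp only [barnesBoxSum, barnesLin_add]

theorem exists_rpow_le (v₀ v₁ e₀ e₁ : ℝ) (h : 0 < v₀) : ∃ D : ℝ, 0 ≤ D ∧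
    ∀ v e : ℝ, v₀ ≤ v → v ≤ v₁ → e₀ ≤ e → e ≤ e₁ → v ^ e ≤ D := by
  have hc : ContinuousOn (fun p : ℝ × ℝ ↦ p.1 ^ p.2) (Icc v₀ v₁ ×ˢ Icc e₀ e₁) := fun p hp ↦
    (Real.continuousAt_rpow p (Or.inl (h.trans_le hp.1.1).ne')).continuousWithinAt
  obtain ⟨D, hD⟩ := (isCompact_Icc.prod isCompact_Icc).exists_bound_of_continuousOn hc
  refine ⟨|D|, abs_nonneg D, fun v e h1 h2 h3 h4 ↦ ?_⟩
  exact (le_abs_self _).trans ((hD (v, e) ⟨⟨h1, h2⟩, ⟨h3, h4⟩⟩).trans (le_abs_self D))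

theorem barnesCont_sub_shift_nat {r : ℕ} {w : Fin (r + 1) → ℝ} (hw : ∀ j, 0 < w j) {s : ℂ}
    (hs : s.im ≠ 0) {x : ℝ} (hx : 0 < x) (N : ℕ) :
    barnesCont w s x - barnesCont w s (x + N * w 0) =
      ∑ n ∈ Finset.range N, barnesCont (Fin.tail w) s (x + n * w 0) := by
  have h := Finset.sum_range_sub' (fun n : ℕ ↦ barnesCont w s (x + n * w 0)) N
  simp only [Nat.cast_zero, zero_mul, add_zero] at h
  rw [← h]
  refine Finset.sum_congr rfl fun n _ ↦ ?_
  have hw0 := hw 0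
  rw [← barnesCont_sub_shift hw hs (by positivity)]
  congr 2
  push_cast; ring

theorem norm_le_mul_im {σ₀ σ₁ : ℝ} {s : ℂ} (h0 : σ₀ ≤ s.re) (h1 : s.re ≤ σ₁) (ht : 1 ≤ s.im) :
    ‖s‖ ≤ (1 + |σ₀| + |σ₁|) * s.im := by
  have h2 := Complex.norm_le_abs_re_add_abs_im s
  have h3 : |s.re| ≤ |σ₀| + |σ₁| := by
    refine abs_le.2 ⟨?_, ?_⟩
    · linarith [neg_abs_le σ₀, abs_nonneg σ₁]
    · linarith [le_abs_self σ₁, abs_nonneg σ₀]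
  rw [abs_of_nonneg (by linarith : 0 ≤ s.im)] at h2
  nlinarith [abs_nonneg σ₀, abs_nonneg σ₁]

/-- Telescoping in coordinate 0 splits the error into the value at the far shift `x + N w₀`, where
the bound for large shifts applies, and `N ≪ t` errors with one variable fewer. `B` is quantified
after `Y` because the induction applies the tail estimate at shifts up to `(B + 2 Y w₀) t`. -/
theorem norm_barnesCont_sub_boxSum_le (r : ℕ) : ∀ (w : Fin r → ℝ), (∀ j, 0 < w j) →
    ∀ σ₀ σ₁ : ℝ, ∃ Y₀ : ℝ, 1 ≤ Y₀ ∧ ∀ Y : ℝ, Y₀ ≤ Y → ∀ B : ℝ, ∃ C : ℝ, 0 ≤ C ∧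
      ∀ (s : ℂ) (x : ℝ) (N : ℕ), σ₀ ≤ s.re → s.re ≤ σ₁ → 1 ≤ s.im → 0 < x → x ≤ B * s.im →
        Y * s.im ≤ N → N ≤ 2 * Y * s.im →
        ‖barnesCont w s x - barnesBoxSum w N s x‖ ≤ C * s.im ^ ((r : ℝ) - 1 - s.re) := by
  induction r with
  | zero =>
    intro w hw σ₀ σ₁
    refine ⟨1, le_rfl, fun Y _ B ↦ ⟨0, le_rfl, fun s x N _ _ _ hx _ _ _ ↦ ?_⟩⟩
    rw [barnesCont_zero w hx]
    simp [barnesBoxSum, barnesLin]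
  | succ r ih =>
    intro w hw σ₀ σ₁
    have hw0 := hw 0
    obtain ⟨Y₀, hY₀, hY⟩ := ih (Fin.tail w) (fun j ↦ hw _) σ₀ σ₁
    obtain ⟨C₁, hC₁, X, hX, hlarge⟩ := norm_barnesCont_succ_le hw σ₀
    set S : ℝ := 1 + |σ₀| + |σ₁| with hS
    have hS0 : 0 < S := by positivity
    -- The second entry guarantees `N w₀ ≥ X ‖s‖`, as `‖s‖ ≤ S * s.im` in the strip.
    refine ⟨max Y₀ (X * S / w 0), hY₀.trans (le_max_left _ _), fun Y hYY B ↦ ?_⟩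
    have hY1 : 1 ≤ Y := hY₀.trans ((le_max_left _ _).trans hYY)
    have hYX : X * S ≤ Y * w 0 := (div_le_iff₀ hw0).1 ((le_max_right _ _).trans hYY)
    obtain ⟨C₂, hC₂, htail⟩ := hY Y ((le_max_left _ _).trans hYY) (B + 2 * Y * w 0)
    obtain ⟨D, hD, hpow⟩ := exists_rpow_le (Y * w 0) (B + 2 * Y * w 0) ((r : ℝ) + 1 - σ₁)
      ((r : ℝ) + 1 - σ₀) (by positivity)
    refine ⟨C₁ * D + 2 * Y * C₂, by positivity, fun s x N h0 h1 ht hx hxB hN1 hN2 ↦ ?_⟩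
    have ht0 : 0 < s.im := by linarith
    have hnorm := norm_le_mul_im h0 h1 ht
    rw [← hS] at hnorm
    have e1 : barnesCont w s x - barnesBoxSum w N s x = barnesCont w s (x + N * w 0) +
        ∑ n ∈ Finset.range N, (barnesCont (Fin.tail w) s (x + n * w 0) -
          barnesBoxSum (Fin.tail w) N s (x + n * w 0)) := by
      rw [Finset.sum_sub_distrib, ← barnesBoxSum_succ', ← barnesCont_sub_shift_nat hw ht0.ne' hx]
      ring
    have hNw1 : Y * w 0 * s.im ≤ N * w 0 := by nlinarith
    have hNw2 : N * w 0 ≤ 2 * Y * w 0 * s.im := by nlinarith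
    have b1 : ‖barnesCont w s (x + N * w 0)‖ ≤ C₁ * D * s.im ^ ((r : ℝ) - s.re) := by
      have hXs : X * ‖s‖ ≤ x + N * w 0 := by
        calc X * ‖s‖ ≤ X * (S * s.im) := by gcongr
          _ = X * S * s.im := by ring
          _ ≤ Y * w 0 * s.im := by gcongr
          _ ≤ x + N * w 0 := by linarith
      refine (hlarge s _ h0 ht hXs).trans ?_
      have hv := hpow ((x + N * w 0) / s.im) ((r : ℝ) + 1 - s.re)
        ((le_div_iff₀ ht0).2 (by linarith)) ((div_le_iff₀ ht0).2 (by linarith))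
        (by linarith) (by linarith)
      rw [Real.div_rpow (by positivity) ht0.le, div_le_iff₀ (Real.rpow_pos_of_pos ht0 _)] at hv
      have e2 : s.im ^ ((r : ℝ) + 1 - s.re) = s.im ^ ((r : ℝ) - s.re) * s.im := by
        rw [← Real.rpow_add_one ht0.ne']; congr 1; ring
      rw [e2] at hv
      rw [div_le_iff₀ ht0]
      calc C₁ * (x + N * w 0) ^ ((r : ℝ) + 1 - s.re)
          ≤ C₁ * (D * (s.im ^ ((r : ℝ) - s.re) * s.im)) := by gcongr
        _ = _ := by ring
    have b2 : ‖∑ n ∈ Finset.range N, (barnesCont (Fin.tail w) s (x + n * w 0) -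
          barnesBoxSum (Fin.tail w) N s (x + n * w 0))‖ ≤
        2 * Y * C₂ * s.im ^ ((r : ℝ) - s.re) := by
      have hterm : ∀ n ∈ Finset.range N, ‖barnesCont (Fin.tail w) s (x + n * w 0) -
          barnesBoxSum (Fin.tail w) N s (x + n * w 0)‖ ≤ C₂ * s.im ^ ((r : ℝ) - 1 - s.re) := by
        intro n hn
        have hnN : (n : ℝ) ≤ N := by exact_mod_cast (Finset.mem_range.1 hn).le
        have : (n : ℝ) * w 0 ≤ N * w 0 := by gcongr
        exact htail s _ N h0 h1 ht (by positivity) (by linarith) hN1 hN2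
      refine (norm_sum_le_of_le _ hterm).trans ?_
      rw [Finset.sum_const, Finset.card_range, nsmul_eq_mul]
      have e2 : s.im ^ ((r : ℝ) - s.re) = s.im ^ ((r : ℝ) - 1 - s.re) * s.im := by
        rw [← Real.rpow_add_one ht0.ne']; congr 1; ring
      have hp := Real.rpow_pos_of_pos ht0 ((r : ℝ) - 1 - s.re)
      rw [e2]
      calc (N : ℝ) * (C₂ * s.im ^ ((r : ℝ) - 1 - s.re))
          ≤ (2 * Y * s.im) * (C₂ * s.im ^ ((r : ℝ) - 1 - s.re)) := by gcongr
        _ = _ := by ring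
    rw [e1]
    refine (norm_add_le _ _).trans ((add_le_add b1 b2).trans (le_of_eq ?_))
    push_cast
    rw [← add_mul]
    congr 2
    ring

/-! ### Exponential sums: Kusmin–Landau and the second-derivative test -/

/-- Summation by parts, as an estimate. -/
theorem norm_sum_mul_le_of_partial_sums {c v : ℕ → ℂ} {V : ℝ} (n : ℕ)
    (hV : ∀ k ≤ n + 1, ‖∑ i ∈ Finset.range k, v i‖ ≤ V) :
    ‖∑ i ∈ Finset.range (n + 1), c i * v i‖ ≤
      V * (‖c n‖ + ∑ i ∈ Finset.range n, ‖c (i + 1) - c i‖) := by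
  have h := Finset.sum_range_by_parts c v (n + 1)
  simp only [smul_eq_mul, Nat.add_sub_cancel] at h
  rw [h, mul_add, Finset.mul_sum (Finset.range n) _ V]
  refine (norm_sub_le _ _).trans (add_le_add ?_ ?_)
  · rw [norm_mul, mul_comm]
    exact mul_le_mul_of_nonneg_right (hV _ le_rfl) (norm_nonneg _)
  · refine norm_sum_le_of_le _ fun i hi ↦ ?_
    rw [norm_mul, mul_comm]
    have := Finset.mem_range.1 hi
    exact mul_le_mul_of_nonneg_right (hV _ (by omega)) (norm_nonneg _)

/-- The reciprocal of `1 - e^(-iφ)` has constant real part, so its variation is that of a cotangent.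
-/
theorem half_sub_cot_mul_one_sub_exp {φ : ℝ} (h : Real.sin (φ / 2) ≠ 0) :
    (1 / 2 - Complex.I / 2 * ((Real.cos (φ / 2) / Real.sin (φ / 2) : ℝ) : ℂ)) *
      (1 - Complex.exp (-(φ * Complex.I))) = 1 := by
  have h1 : Complex.exp (-(φ * Complex.I)) =
      ((Real.cos (φ / 2) : ℂ) - Real.sin (φ / 2) * Complex.I) ^ 2 := by
    rw [show -((φ : ℂ) * Complex.I) = ((-(φ / 2) : ℝ) : ℂ) * Complex.I +
      ((-(φ / 2) : ℝ) : ℂ) * Complex.I by push_cast; ring, Complex.exp_add, Complex.exp_mul_I,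
      ← Complex.ofReal_cos, ← Complex.ofReal_sin, Real.cos_neg, Real.sin_neg]
    push_cast; ring
  have h2 : (Real.sin (φ / 2) : ℂ) ≠ 0 := by exact_mod_cast h
  have h3 : (Real.sin (φ / 2) : ℂ) ^ 2 + (Real.cos (φ / 2) : ℂ) ^ 2 = 1 := by
    exact_mod_cast Real.sin_sq_add_cos_sq (φ / 2)
  rw [h1, Complex.ofReal_div]
  generalize (Real.sin (φ / 2) : ℂ) = S at *
  generalize (Real.cos (φ / 2) : ℂ) = C at *
  have hI : Complex.I ^ 2 = -1 := Complex.I_sq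
  field_simp
  have e : C ^ 2 = 1 - S ^ 2 := by linear_combination h3
  have e3 : C ^ 3 = C * (1 - S ^ 2) := by rw [← e]; ring
  have hI3 : Complex.I ^ 3 = -Complex.I := by rw [pow_succ, hI]; ring
  ring_nf
  rw [hI, hI3, e, e3]
  ring

theorem div_pi_le_sin_half {φ δ : ℝ} (hδ : 0 < δ) (h1 : δ ≤ φ) (h2 : φ ≤ 2 * Real.pi - δ) :
    δ / Real.pi ≤ Real.sin (φ / 2) := by
  have hpi := Real.pi_pos
  rcases le_total φ Real.pi with h | h
  · refine le_trans ?_ (Real.mul_le_sin (by linarith : 0 ≤ φ / 2) (by linarith))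
    rw [div_mul_div_comm, mul_comm Real.pi 2, mul_div_mul_left _ _ two_ne_zero]
    gcongr
  · rw [← Real.sin_pi_sub]
    refine le_trans ?_ (Real.mul_le_sin (by linarith : 0 ≤ Real.pi - φ / 2) (by linarith))
    rw [div_mul_eq_mul_div]
    gcongr
    linarith

theorem abs_cot_half_le {φ δ : ℝ} (hδ : 0 < δ) (h1 : δ ≤ φ) (h2 : φ ≤ 2 * Real.pi - δ) :
    |Real.cos (φ / 2) / Real.sin (φ / 2)| ≤ Real.pi / δ := by
  have h := div_pi_le_sin_half hδ h1 h2
  have hpos : 0 < δ / Real.pi := div_pos hδ Real.pi_pos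
  rw [abs_div, abs_of_pos (hpos.trans_le h), ← one_div_div δ]
  exact div_le_div₀ zero_le_one (Real.abs_cos_le_one _) hpos h

theorem cot_half_anti {φ ψ : ℝ} (hφ : 0 < φ) (hψ : ψ < 2 * Real.pi) (h : φ ≤ ψ) :
    Real.cos (ψ / 2) / Real.sin (ψ / 2) ≤ Real.cos (φ / 2) / Real.sin (φ / 2) := by
  have h1 : 0 < Real.sin (φ / 2) := Real.sin_pos_of_pos_of_lt_pi (by linarith) (by linarith)
  have h2 : 0 < Real.sin (ψ / 2) := Real.sin_pos_of_pos_of_lt_pi (by linarith) (by linarith)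
  have h3 : 0 ≤ Real.sin (ψ / 2 - φ / 2) :=
    Real.sin_nonneg_of_nonneg_of_le_pi (by linarith) (by linarith)
  rw [Real.sin_sub] at h3
  rw [div_le_div_iff₀ h2 h1]
  linarith

/-- The Kusmin–Landau inequality for unimodular sequences with monotone phase increments. -/
theorem norm_sum_le_of_phase_increments {u : ℕ → ℂ} {φ : ℕ → ℝ} {δ : ℝ} (hδ : 0 < δ) (n : ℕ)
    (hu : ∀ i, ‖u i‖ ≤ 1)
    (hstep : ∀ i < n, u (i + 1) = u i * Complex.exp (-(φ i * Complex.I)))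
    (hφ : ∀ i < n, δ ≤ φ i ∧ φ i ≤ 2 * Real.pi - δ)
    (hanti : ∀ i, i + 1 < n → φ (i + 1) ≤ φ i) :
    ‖∑ i ∈ Finset.range n, u i‖ ≤ 4 * Real.pi / δ := by
  have hpi := Real.pi_pos
  rcases n with _ | n
  · simp; positivity
  set c : ℕ → ℝ := fun i ↦ Real.cos (φ i / 2) / Real.sin (φ i / 2) with hc
  set g : ℕ → ℂ := fun i ↦ 1 / 2 - Complex.I / 2 * (c i : ℂ) with hg
  have hcb : ∀ i < n + 1, |c i| ≤ Real.pi / δ := fun i hi ↦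
    abs_cot_half_le hδ (hφ i hi).1 (hφ i hi).2
  have hδpi : δ ≤ Real.pi := by have := hφ 0 (by omega); linarith
  -- Each term becomes a weight times a difference whose partial sums telescope to norm at most 2;
  -- summation by parts then needs only the variation of `g`.
  have hterm : ∀ i ∈ Finset.range (n + 1), u i = g i * (u i - u (i + 1)) := by
    intro i hi
    have hi := Finset.mem_range.1 hi
    have hs : Real.sin (φ i / 2) ≠ 0 :=
      ((div_pos hδ hpi).trans_le (div_pi_le_sin_half hδ (hφ i hi).1 (hφ i hi).2)).ne'
    have h := half_sub_cot_mul_one_sub_exp hs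
    rw [hstep i hi]
    simp only [hg, hc]
    linear_combination -(u i) * h
  rw [Finset.sum_congr rfl hterm]
  have hnorm : ∀ i, ‖g (i + 1) - g i‖ = 1 / 2 * |c (i + 1) - c i| := by
    intro i
    have : g (i + 1) - g i = -(Complex.I / 2) * ((c (i + 1) - c i : ℝ) : ℂ) := by
      simp only [hg]; push_cast; ring
    rw [this, norm_mul, Complex.norm_real, Real.norm_eq_abs]
    simp
  have hsum : ∑ i ∈ Finset.range n, ‖g (i + 1) - g i‖ ≤ Real.pi / δ := by
    have : ∀ i ∈ Finset.range n, ‖g (i + 1) - g i‖ = 1 / 2 * (c (i + 1) - c i) := by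
      intro i hi
      have hi := Finset.mem_range.1 hi
      rw [hnorm, abs_of_nonneg]
      refine sub_nonneg.2 (cot_half_anti (hδ.trans_le (hφ (i + 1) (by omega)).1) ?_
        (hanti i (by omega)))
      linarith [(hφ i (by omega)).2]
    rw [Finset.sum_congr rfl this, ← Finset.mul_sum, Finset.sum_range_sub]
    have h1 := abs_le.1 (hcb n (by omega))
    have h2 := abs_le.1 (hcb 0 (by omega))
    linarith
  have hgn : ‖g n‖ ≤ Real.pi / δ := by
    have h1 : ‖g n‖ ≤ 1 / 2 + 1 / 2 * |c n| := by
      refine (norm_sub_le _ _).trans (add_le_add (by simp) ?_)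
      rw [norm_mul, Complex.norm_real, Real.norm_eq_abs]
      simp
    have h2 := hcb n (by omega)
    have h3 : 1 ≤ Real.pi / δ := (one_le_div hδ).2 hδpi
    linarith
  refine (norm_sum_mul_le_of_partial_sums (V := 2) n fun k _ ↦ ?_).trans ?_
  · rw [Finset.sum_range_sub']
    refine (norm_sub_le _ _).trans ?_
    linarith [hu 0, hu k]
  · have e : 4 * Real.pi / δ = 2 * (Real.pi / δ + Real.pi / δ) := by ring
    rw [e]
    gcongr

theorem Finset.exists_eq_Ico_of_ordConnected (T : Finset ℕ)
    (hT : ∀ i ∈ T, ∀ k ∈ T, ∀ j, i ≤ j → j ≤ k → j ∈ T) : ∃ p n, T = Finset.Ico p (p + n) := by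
  rcases T.eq_empty_or_nonempty with h | h
  · exact ⟨0, 0, by simp [h]⟩
  · refine ⟨T.min' h, T.max' h + 1 - T.min' h, ?_⟩
    have hle := T.min'_le_max' h
    ext j
    rw [Finset.mem_Ico]
    constructor
    · intro hj
      have h1 := T.min'_le j hj
      have h2 := T.le_max' j hj
      omega
    · intro hj
      exact hT _ (T.min'_mem h) _ (T.max'_mem h) j hj.1 (by omega)

theorem card_le_of_spacing {θ : ℕ → ℝ} {ℓ δ b : ℝ} (hℓ : 0 < ℓ) (hδ : 0 ≤ δ) {n : ℕ}
    (hgap : ∀ i k, i ≤ k → k < n → θ k + ((k : ℝ) - i) * ℓ ≤ θ i) (T : Finset ℕ)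
    (hTn : ∀ i ∈ T, i < n) (hT : ∀ i ∈ T, b ≤ θ i ∧ θ i ≤ b + δ) : (T.card : ℝ) ≤ δ / ℓ + 1 := by
  rcases T.eq_empty_or_nonempty with h | h
  · simp [h]; positivity
  · have hle := T.min'_le_max' h
    have hsub : T ⊆ Finset.Icc (T.min' h) (T.max' h) := fun j hj ↦
      Finset.mem_Icc.2 ⟨T.min'_le j hj, T.le_max' j hj⟩
    have hcard := Finset.card_le_card hsub
    rw [Nat.card_Icc] at hcard
    have h1 := hgap _ _ hle (hTn _ (T.max'_mem h))
    have h2 := hT _ (T.min'_mem h)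
    have h3 := hT _ (T.max'_mem h)
    have h4 : ((T.max' h : ℝ) - T.min' h) ≤ δ / ℓ := (le_div_iff₀ hℓ).2 (by linarith)
    have h5 : T.card + T.min' h ≤ T.max' h + 1 := by omega
    have h6 : (T.card : ℝ) + T.min' h ≤ T.max' h + 1 := by exact_mod_cast h5
    linarith

/-- The second-derivative test for unimodular sequences. -/
theorem norm_sum_le_of_phase_spacing {u : ℕ → ℂ} {θ : ℕ → ℝ} {ℓ L : ℝ} (hℓ : 0 < ℓ) (hL : 0 ≤ L)
    (n : ℕ) (hu : ∀ i, ‖u i‖ ≤ 1)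
    (hstep : ∀ i < n, u (i + 1) = u i * Complex.exp (-(θ i * Complex.I)))
    (hθ : ∀ i < n, 0 ≤ θ i ∧ θ i ≤ L)
    (hspace : ∀ i, i + 1 < n → θ (i + 1) + ℓ ≤ θ i) :
    ‖∑ i ∈ Finset.range n, u i‖ ≤ (L + 1) * (15 / √ℓ + 2) := by
  have hpi := Real.pi_pos
  have hpi3 := Real.pi_gt_three
  have hpi4 : Real.pi < 3.25 := Real.pi_lt_d2.trans (by norm_num)
  -- This choice balances the number `δ / ℓ` of increments within `δ` of a multiple of 2π against
  -- the Kusmin–Landau bound of order `1 / δ`.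
  set δ := √ℓ with hδdef
  have hδ : 0 < δ := Real.sqrt_pos.2 hℓ
  have hgap : ∀ i k, i ≤ k → k < n → θ k + ((k : ℝ) - i) * ℓ ≤ θ i := by
    intro i k hik
    induction k, hik using Nat.le_induction with
    | base => intro _; simp
    | succ k hik ih =>
      intro hk
      have h1 := ih (by omega)
      have h2 := hspace k hk
      push_cast
      linarith
  have hmono : ∀ i k, i ≤ k → k < n → θ k ≤ θ i := by
    intro i k hik hk
    have h1 := hgap i k hik hk
    have h2 : (0 : ℝ) ≤ (k : ℝ) - i := sub_nonneg.2 (by exact_mod_cast hik)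
    nlinarith
  -- Increments are grouped by period; in each group the two edges are counted trivially and the
  -- middle, an interval of indices by monotonicity, is handled by Kusmin–Landau.
  set q : ℕ → ℕ := fun i ↦ ⌊θ i / (2 * Real.pi)⌋₊ with hq
  set Q := ⌊L / (2 * Real.pi)⌋₊ + 1 with hQ
  have hmaps : ∀ i ∈ Finset.range n, q i ∈ Finset.range Q := by
    intro i hi
    have hi := Finset.mem_range.1 hi
    rw [Finset.mem_range, hQ, Nat.lt_succ_iff]
    exact Nat.floor_mono (by gcongr; exact (hθ i hi).2)
  rw [← Finset.sum_fiberwise_of_maps_to hmaps]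
  have hQle : (Q : ℝ) ≤ L + 1 := by
    rw [hQ]; push_cast
    have h1 := Nat.floor_le (show 0 ≤ L / (2 * Real.pi) by positivity)
    have h2 : L / (2 * Real.pi) ≤ L := div_le_self hL (by linarith)
    linarith
  have hfib : ∀ k ∈ Finset.range Q, ‖∑ i ∈ Finset.range n with q i = k, u i‖ ≤ 15 / δ + 2 := by
    intro k _
    set T := Finset.filter (fun i ↦ q i = k) (Finset.range n) with hTdef
    have hTn : ∀ i ∈ T, i < n := fun i hi ↦ Finset.mem_range.1 (Finset.mem_filter.1 hi).1
    have hbound : ∀ i ∈ T, 2 * Real.pi * k ≤ θ i ∧ θ i < 2 * Real.pi * k + 2 * Real.pi := by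
      intro i hi
      obtain ⟨h1, h2⟩ := Finset.mem_filter.1 hi
      have h3 := (hθ i (Finset.mem_range.1 h1)).1
      have h4 := (Nat.floor_eq_iff (by positivity)).1 h2
      rw [le_div_iff₀ (by positivity), div_lt_iff₀ (by positivity)] at h4
      constructor <;> linarith
    rw [← Finset.sum_filter_add_sum_filter_not T (fun i ↦ θ i < 2 * Real.pi * k + δ),
      ← Finset.sum_filter_add_sum_filter_not (Finset.filter (fun i ↦ ¬ θ i < 2 * Real.pi * k + δ) T)
        (fun i ↦ 2 * Real.pi * k + 2 * Real.pi - δ < θ i)]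
    set T₁ := Finset.filter (fun i ↦ θ i < 2 * Real.pi * k + δ) T
    set T' := Finset.filter (fun i ↦ ¬ θ i < 2 * Real.pi * k + δ) T
    set T₂ := Finset.filter (fun i ↦ 2 * Real.pi * k + 2 * Real.pi - δ < θ i) T'
    set T₃ := Finset.filter (fun i ↦ ¬ 2 * Real.pi * k + 2 * Real.pi - δ < θ i) T' with hT₃
    have hδℓ : δ / ℓ = 1 / δ := by
      rw [div_eq_div_iff hℓ.ne' hδ.ne', one_mul, hδdef, Real.mul_self_sqrt hℓ.le]
    have b1 : ‖∑ i ∈ T₁, u i‖ ≤ 1 / δ + 1 := by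
      refine (norm_sum_le_of_le _ fun i _ ↦ hu i).trans ?_
      rw [Finset.sum_const, nsmul_eq_mul, mul_one, ← hδℓ]
      refine card_le_of_spacing (b := 2 * Real.pi * k) hℓ hδ.le hgap T₁
        (fun i hi ↦ hTn i (Finset.mem_filter.1 hi).1) fun i hi ↦ ?_
      obtain ⟨h1, h2⟩ := Finset.mem_filter.1 hi
      exact ⟨(hbound i h1).1, h2.le⟩
    have b2 : ‖∑ i ∈ T₂, u i‖ ≤ 1 / δ + 1 := by
      refine (norm_sum_le_of_le _ fun i _ ↦ hu i).trans ?_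
      rw [Finset.sum_const, nsmul_eq_mul, mul_one, ← hδℓ]
      refine card_le_of_spacing (b := 2 * Real.pi * k + 2 * Real.pi - δ) hℓ hδ.le hgap T₂
        (fun i hi ↦ hTn i (Finset.mem_filter.1 (Finset.mem_filter.1 hi).1).1) fun i hi ↦ ?_
      obtain ⟨h1, h2⟩ := Finset.mem_filter.1 hi
      have h3 := hbound i (Finset.mem_filter.1 h1).1
      exact ⟨h2.le, by linarith⟩
    have b3 : ‖∑ i ∈ T₃, u i‖ ≤ 4 * Real.pi / δ := by
      have hmem : ∀ i, i ∈ T₃ ↔ i < n ∧ q i = k ∧ 2 * Real.pi * k + δ ≤ θ i ∧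
          θ i ≤ 2 * Real.pi * k + 2 * Real.pi - δ := by
        intro i
        simp only [T₃, T', T, Finset.mem_filter, Finset.mem_range, not_lt]
        tauto
      obtain ⟨p, N, hpN⟩ := Finset.exists_eq_Ico_of_ordConnected T₃ (by
        intro i hi k' hk' j hij hjk
        rw [hmem] at hi hk' ⊢
        have h1 := hmono i j hij (by omega)
        have h2 := hmono j k' hjk hk'.1
        refine ⟨by omega, le_antisymm ?_ ?_, by linarith [hk'.2.2.1], by linarith [hi.2.2.2]⟩
        · rw [← hi.2.1]
          exact Nat.floor_mono (by gcongr)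
        · rw [← hk'.2.1]
          exact Nat.floor_mono (by gcongr))
      have hin : ∀ i < N, p + i < n ∧ q (p + i) = k ∧ 2 * Real.pi * k + δ ≤ θ (p + i) ∧
          θ (p + i) ≤ 2 * Real.pi * k + 2 * Real.pi - δ := fun i hi ↦
        (hmem _).1 (by rw [hpN, Finset.mem_Ico]; omega)
      rw [hpN, Finset.sum_Ico_eq_sum_range, Nat.add_sub_cancel_left]
      refine norm_sum_le_of_phase_increments (φ := fun i ↦ θ (p + i) - 2 * Real.pi * k) hδ N
        (fun i ↦ hu _) (fun i hi ↦ ?_) (fun i hi ↦ ?_) (fun i hi ↦ ?_)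
      · rw [← add_assoc, hstep _ (hin i hi).1]
        congr 1
        refine Complex.exp_eq_exp_iff_exists_int.2 ⟨-k, ?_⟩
        push_cast; ring
      · have := hin i hi
        exact ⟨by linarith, by linarith⟩
      · have := hmono (p + i) (p + (i + 1)) (by omega) (hin (i + 1) hi).1
        linarith
    refine (norm_add_le _ _).trans ?_
    have h23 := (norm_add_le (∑ i ∈ T₂, u i) (∑ i ∈ T₃, u i)).trans (add_le_add b2 b3)
    have e : 1 / δ + 1 + (1 / δ + 1 + 4 * Real.pi / δ) = (2 + 4 * Real.pi) / δ + 2 := by ring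
    refine (add_le_add b1 h23).trans ?_
    rw [e]
    gcongr
    linarith
  refine (norm_sum_le_of_le _ hfib).trans ?_
  rw [Finset.sum_const, Finset.card_range, nsmul_eq_mul]
  have : 0 ≤ 15 / δ + 2 := by positivity
  gcongr

theorem norm_exp_neg_mul_I (x : ℝ) : ‖Complex.exp (-(x * Complex.I))‖ = 1 := by
  rw [← neg_mul, ← Complex.ofReal_neg, Complex.norm_exp_ofReal_mul_I]

theorem card_mul_le_of_progression {y w M : ℝ} (hw : 0 < w) (hM : 0 ≤ M) {n : ℕ}
    (h : ∀ i < n, M ≤ y + i * w ∧ y + i * w ≤ 2 * M) : (n : ℝ) ≤ M / w + 1 := by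
  rcases n with _ | n
  · simp; positivity
  · have h1 := (h 0 (by omega)).1
    have h2 := (h n (by omega)).2
    simp only [Nat.cast_zero, zero_mul, add_zero] at h1
    push_cast
    have : (n : ℝ) ≤ M / w := (le_div_iff₀ hw).2 (by linarith)
    linarith

theorem norm_sum_exp_log_progression_le {w B : ℝ} (hw : 0 < w) (hB : 0 ≤ B) : ∃ C : ℝ, 0 ≤ C ∧
    ∀ (y M t : ℝ) (n : ℕ), 1 ≤ t → 0 < M → M ≤ B * t →
      (∀ i < n, M ≤ y + i * w ∧ y + i * w ≤ 2 * M) →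
      ‖∑ i ∈ Finset.range n, Complex.exp (-(((t * Real.log (y + i * w) : ℝ) : ℂ) * Complex.I))‖ ≤
        C * √t := by
  refine ⟨1 / w + 1 + (32 + 30 * B / w + 2 * w), by positivity, fun y M t n ht hM hMB h ↦ ?_⟩
  have ht0 : 0 < t := by linarith
  have hst : 1 ≤ √t := Real.one_le_sqrt.2 ht
  have hst0 : 0 < √t := by linarith
  have htt : √t * √t = t := Real.mul_self_sqrt ht0.le
  -- For `M ≤ √t` counting terms suffices. Otherwise the test gives terms of order `√t`, `M / √t`,
  -- `t / M` and 1, all `≪ √t` because `√t ≤ M ≤ B t`.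
  rcases le_total M √t with hMt | hMt
  · refine (norm_sum_le_of_le (f := fun i : ℕ ↦
      Complex.exp (-(((t * Real.log (y + i * w) : ℝ) : ℂ) * Complex.I))) _
      fun i _ ↦ (norm_exp_neg_mul_I _).le).trans ?_
    rw [Finset.sum_const, Finset.card_range, nsmul_eq_mul, mul_one]
    have h1 := card_mul_le_of_progression hw hM.le h
    have h2 : M / w ≤ 1 / w * √t := by rw [one_div_mul_eq_div]; gcongr
    have h3 : 0 ≤ (32 + 30 * B / w + 2 * w) * √t := by positivity
    nlinarith
  rcases Nat.eq_zero_or_pos n with hn | hn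
  · subst hn; simp; positivity
  have hy : 0 < y := by
    have := (h 0 hn).1; simp only [Nat.cast_zero, zero_mul, add_zero] at this; linarith
  have hpos : ∀ i : ℕ, 0 < y + i * w := fun i ↦ by positivity
  set θ : ℕ → ℝ := fun i ↦ t * (Real.log (y + (i + 1 : ℕ) * w) - Real.log (y + i * w)) with hθdef
  set ℓ : ℝ := t * w ^ 2 / (4 * M ^ 2) with hℓdef
  have hℓ : 0 < ℓ := by positivity
  have hsqrt : √ℓ = w * √t / (2 * M) := by
    rw [Real.sqrt_eq_iff_mul_self_eq hℓ.le (by positivity), hℓdef]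
    field_simp
    linear_combination -4 * htt
  have key := norm_sum_le_of_phase_spacing (θ := θ) (L := t * w / M) hℓ (by positivity) n
    (u := fun i : ℕ ↦ Complex.exp (-(((t * Real.log (y + i * w) : ℝ) : ℂ) * Complex.I)))
    (fun i ↦ (norm_exp_neg_mul_I _).le)
    (fun i _ ↦ by
      rw [← Complex.exp_add]
      congr 1
      simp only [hθdef]
      push_cast; ring)
    (fun i hi ↦ by
      have h1 := h i hi
      have hlog : Real.log (y + (i + 1 : ℕ) * w) - Real.log (y + i * w) =
          Real.log (1 + w / (y + i * w)) := by
        rw [← Real.log_div (hpos _).ne' (hpos _).ne']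
        congr 1
        have := (hpos i).ne'
        field_simp
        push_cast; ring
      have hq : 0 ≤ w / (y + i * w) := div_nonneg hw.le (hpos i).le
      simp only [hθdef]
      rw [hlog]
      constructor
      · exact mul_nonneg ht0.le (Real.log_nonneg (by linarith))
      · rw [mul_div_assoc]
        refine mul_le_mul_of_nonneg_left ?_ ht0.le
        have h2 := Real.log_le_sub_one_of_pos (show 0 < 1 + w / (y + i * w) by linarith)
        have h3 : w / (y + i * w) ≤ w / M := by gcongr; exact h1.1
        linarith)
    (fun i hi ↦ by
      have h1 := h (i + 1) hi
      set z := y + ((i + 1 : ℕ) : ℝ) * w with hz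
      have hz0 : 0 < z := hpos _
      have e0 : y + (i : ℝ) * w = z - w := by rw [hz]; push_cast; ring
      have e2 : y + ((i + 1 + 1 : ℕ) : ℝ) * w = z + w := by rw [hz]; push_cast; ring
      have p0 : 0 < z - w := e0 ▸ hpos i
      have p2 : 0 < z + w := by linarith
      simp only [hθdef]
      rw [← hz, e0, e2]
      -- The second difference of the logarithm is `log (1 - w²/z²) ≤ -w²/z²`, and `z ≤ 2M`.
      have hl : Real.log (z - w) + Real.log (z + w) - 2 * Real.log z ≤ -(w ^ 2 / (4 * M ^ 2)) := by
        have e3 : Real.log (z - w) + Real.log (z + w) - 2 * Real.log z =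
            Real.log (1 - w ^ 2 / z ^ 2) := by
          rw [← Real.log_mul p0.ne' p2.ne', show 2 * Real.log z = Real.log (z ^ 2) by
            rw [Real.log_pow]; norm_num, ← Real.log_div (mul_pos p0 p2).ne' (by positivity)]
          congr 1
          field_simp
          ring
        have hq : w ^ 2 / z ^ 2 < 1 := by
          rw [div_lt_one (by positivity)]; nlinarith
        have h2 := Real.log_le_sub_one_of_pos (show 0 < 1 - w ^ 2 / z ^ 2 by linarith)
        have h3 : w ^ 2 / (4 * M ^ 2) ≤ w ^ 2 / z ^ 2 := by
          have : z ^ 2 ≤ 4 * M ^ 2 := by nlinarith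
          gcongr
        rw [e3]; linarith
      have : t * w ^ 2 / (4 * M ^ 2) = t * (w ^ 2 / (4 * M ^ 2)) := mul_div_assoc _ _ _
      rw [hℓdef, this]
      nlinarith)
  refine key.trans ?_
  rw [hsqrt]
  have e1 : (t * w / M + 1) * (15 / (w * √t / (2 * M)) + 2) =
      30 * (t / √t) + 30 * M / (w * √t) + 2 * w * (t / M) + 2 := by
    field_simp
    ring
  have e2 : t / √t = √t := Real.div_sqrt
  have e3 : M / √t ≤ B * √t := by
    rw [div_le_iff₀ hst0, mul_assoc, htt]; exact hMB
  have e4 : t / M ≤ √t := by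
    rw [div_le_iff₀ hM]; nlinarith
  have e5 : 30 * M / (w * √t) = 30 / w * (M / √t) := by field_simp
  have e6 : 30 / w * (M / √t) ≤ 30 / w * (B * √t) := by gcongr
  have e7 : 2 * w * (t / M) ≤ 2 * w * √t := by gcongr
  have e8 : 0 ≤ (1 / w + 1) * √t := by positivity
  have e9 : 30 / w * (B * √t) = 30 * B / w * √t := by ring
  have e10 : (1 / w + 1 + (32 + 30 * B / w + 2 * w)) * √t =
      (1 / w + 1) * √t + 32 * √t + 30 * B / w * √t + 2 * w * √t := by ring
  rw [e1, e2, e5, e10]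
  linarith

/-! ### Power sums along a progression inside a dyadic interval -/

theorem ofReal_cpow_neg_eq {y : ℝ} (hy : 0 < y) (s : ℂ) : (y : ℂ) ^ (-s) =
    ((y ^ (-s.re) : ℝ) : ℂ) * Complex.exp (-(((s.im * Real.log y : ℝ) : ℂ) * Complex.I)) := by
  rw [Complex.cpow_def_of_ne_zero (by exact_mod_cast hy.ne'), Real.rpow_def_of_pos hy,
    Complex.ofReal_exp, ← Complex.exp_add, ← Complex.ofReal_log hy.le]
  congr 1
  conv_lhs => rw [← Complex.re_add_im s]
  push_cast; ring

theorem norm_sum_cpow_progression_le {w B a : ℝ} (hw : 0 < w) (hB : 0 ≤ B) (ha : 0 < a)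
    (σ₀ σ₁ : ℝ) : ∃ C : ℝ, 0 ≤ C ∧ ∀ (s : ℂ) (y M : ℝ) (n : ℕ), σ₀ ≤ s.re → s.re ≤ σ₁ →
      1 ≤ s.im → a ≤ M → M ≤ B * s.im → (∀ i < n, M ≤ y + i * w ∧ y + i * w ≤ 2 * M) →
      ‖∑ i ∈ Finset.range n, ((y + i * w : ℝ) : ℂ) ^ (-s)‖ ≤ C * (M ^ (-s.re) * min M √s.im) := by
  obtain ⟨C₁, hC₁, hsum⟩ := norm_sum_exp_log_progression_le hw hB
  obtain ⟨D, hD, hpow⟩ := exists_rpow_le 1 2 (-σ₁) (-σ₀) one_pos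
  refine ⟨D * (1 / w + 1 / a) + 2 * C₁ * D, by positivity, fun s y M n h0 h1 ht haM hMB h ↦ ?_⟩
  have hM : 0 < M := ha.trans_le haM
  have hMp := Real.rpow_pos_of_pos hM (-s.re)
  have hpos : ∀ i < n, 0 < y + i * w := fun i hi ↦ hM.trans_le (h i hi).1
  have hc : ∀ i < n, (y + i * w) ^ (-s.re) ≤ D * M ^ (-s.re) := by
    intro i hi
    have h2 := hpow ((y + i * w) / M) (-s.re) ((le_div_iff₀ hM).2 (by linarith [(h i hi).1]))
      ((div_le_iff₀ hM).2 (h i hi).2) (by linarith) (by linarith)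
    rwa [Real.div_rpow (hpos i hi).le hM.le, div_le_iff₀ hMp] at h2
  have hP : 0 ≤ M ^ (-s.re) * min M √s.im := by positivity
  have b1 : ‖∑ i ∈ Finset.range n, ((y + i * w : ℝ) : ℂ) ^ (-s)‖ ≤
      D * (1 / w + 1 / a) * (M ^ (-s.re) * M) := by
    have hterm : ∀ i ∈ Finset.range n, ‖((y + i * w : ℝ) : ℂ) ^ (-s)‖ ≤ D * M ^ (-s.re) := by
      intro i hi
      have hi := Finset.mem_range.1 hi
      rw [norm_ofReal_cpow_neg (hpos i hi)]
      exact hc i hi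
    refine (norm_sum_le_of_le _ hterm).trans ?_
    rw [Finset.sum_const, Finset.card_range, nsmul_eq_mul]
    have hn := card_mul_le_of_progression hw hM.le h
    have h1M : 1 ≤ M / a := (one_le_div ha).2 haM
    have hn' : (n : ℝ) ≤ (1 / w + 1 / a) * M := by
      rw [add_mul, one_div_mul_eq_div, one_div_mul_eq_div]; linarith
    calc (n : ℝ) * (D * M ^ (-s.re)) ≤ ((1 / w + 1 / a) * M) * (D * M ^ (-s.re)) := by gcongr
      _ = _ := by ring
  have b2 : ‖∑ i ∈ Finset.range n, ((y + i * w : ℝ) : ℂ) ^ (-s)‖ ≤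
      2 * C₁ * D * (M ^ (-s.re) * √s.im) := by
    rcases n with _ | n
    · simp; positivity
    set c : ℕ → ℝ := fun i ↦ (y + i * w) ^ (-s.re) with hcdef
    have hy : 0 < y := by simpa using hpos 0 (by omega)
    have hcpos : ∀ i, 0 ≤ c i := fun i ↦ Real.rpow_nonneg (by positivity) _
    have e : ∀ i ∈ Finset.range (n + 1), ((y + i * w : ℝ) : ℂ) ^ (-s) = (c i : ℂ) *
        Complex.exp (-(((s.im * Real.log (y + i * w) : ℝ) : ℂ) * Complex.I)) := fun i hi ↦
      ofReal_cpow_neg_eq (hpos i (Finset.mem_range.1 hi)) s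
    rw [Finset.sum_congr rfl e]
    have habel := norm_sum_mul_le_of_partial_sums (c := fun i ↦ (c i : ℂ)) (V := C₁ * √s.im)
      (v := fun i : ℕ ↦ Complex.exp (-(((s.im * Real.log (y + i * w) : ℝ) : ℂ) * Complex.I)))
      n (fun k hk ↦ hsum y M s.im k ht hM hMB fun i hi ↦ h i (by omega))
    refine habel.trans ?_
    -- The weight is monotone, in a direction fixed by the sign of `s.re`, so its total variation
    -- telescopes.
    have hvar : ∑ i ∈ Finset.range n, ‖(c (i + 1) : ℂ) - c i‖ = |c n - c 0| := by
      have e1 : ∀ i, ‖(c (i + 1) : ℂ) - c i‖ = |c (i + 1) - c i| := fun i ↦ by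
        rw [← Complex.ofReal_sub, Complex.norm_real, Real.norm_eq_abs]
      simp only [e1]
      have hlt : ∀ i j : ℕ, i ≤ j → y + i * w ≤ y + j * w := fun i j hij ↦ by gcongr
      rcases le_total (-s.re) 0 with hs | hs
      · have hanti : ∀ i j : ℕ, i ≤ j → c j ≤ c i := fun i j hij ↦
          Real.rpow_le_rpow_of_nonpos (by positivity) (hlt i j hij) hs
        have e2 : ∀ i, |c (i + 1) - c i| = c i - c (i + 1) := fun i ↦ by
          rw [abs_of_nonpos (sub_nonpos.2 (hanti i (i + 1) (by omega)))]; ring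
        simp only [e2]
        rw [Finset.sum_range_sub', abs_of_nonpos (sub_nonpos.2 (hanti 0 n (by omega)))]
        ring
      · have hmono : ∀ i j : ℕ, i ≤ j → c i ≤ c j := fun i j hij ↦
          Real.rpow_le_rpow (by positivity) (hlt i j hij) hs
        have e2 : ∀ i, |c (i + 1) - c i| = c (i + 1) - c i := fun i ↦
          abs_of_nonneg (sub_nonneg.2 (hmono i (i + 1) (by omega)))
        simp only [e2]
        rw [Finset.sum_range_sub, abs_of_nonneg (sub_nonneg.2 (hmono 0 n (by omega)))]
    rw [hvar, Complex.norm_real, Real.norm_of_nonneg (hcpos n)]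
    have hcn := hc n (by omega)
    have hc0 := hc 0 (by omega)
    have habs : |c n - c 0| ≤ D * M ^ (-s.re) := abs_sub_le_of_nonneg_of_le (hcpos n) hcn (hcpos 0) hc0
    calc C₁ * √s.im * (c n + |c n - c 0|)
        ≤ C₁ * √s.im * (D * M ^ (-s.re) + D * M ^ (-s.re)) := by gcongr
      _ = _ := by ring
  rcases le_total M √s.im with hm | hm
  · rw [min_eq_left hm] at hP ⊢
    refine b1.trans ?_
    gcongr
    exact le_add_of_nonneg_right (by positivity)
  · rw [min_eq_right hm] at hP ⊢
    refine b2.trans ?_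
    gcongr
    exact le_add_of_nonneg_left (by positivity)

/-! ### Dyadic decomposition of the box sum -/

/-- The index `k` of the dyadic shell `a 2^k ≤ y < a 2^(k+1)` containing `y`. -/
noncomputable def dyadicIndex (a y : ℝ) : ℕ := Nat.log 2 ⌊y / a⌋₊

theorem dyadicIndex_spec {a y : ℝ} (ha : 0 < a) (hy : a ≤ y) :
    a * 2 ^ dyadicIndex a y ≤ y ∧ y ≤ 2 * (a * 2 ^ dyadicIndex a y) := by
  have h1 : 1 ≤ y / a := (one_le_div ha).2 hy
  have h0 : ⌊y / a⌋₊ ≠ 0 := (Nat.floor_pos.2 h1).ne'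
  constructor
  · have h2 : ((2 ^ dyadicIndex a y : ℕ) : ℝ) ≤ y / a :=
      (Nat.cast_le.2 (Nat.pow_log_le_self 2 h0)).trans (Nat.floor_le (by linarith))
    push_cast at h2
    rw [le_div_iff₀ ha] at h2
    linarith
  · have h2 : ⌊y / a⌋₊ + 1 ≤ 2 ^ (dyadicIndex a y + 1) :=
      Nat.lt_pow_succ_log_self (by norm_num) _
    have h3 : y / a < ((2 ^ (dyadicIndex a y + 1) : ℕ) : ℝ) :=
      (Nat.lt_floor_add_one _).trans_le (by exact_mod_cast h2)
    push_cast at h3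
    rw [div_lt_iff₀ ha, pow_succ] at h3
    linarith

theorem dyadicIndex_mono {a y z : ℝ} (ha : 0 < a) (h : y ≤ z) :
    dyadicIndex a y ≤ dyadicIndex a z :=
  Nat.log_mono_right (Nat.floor_mono (by gcongr))

theorem exists_dyadicIndex_le_log {a B : ℝ} (ha : 0 < a) (haB : a ≤ B) : ∃ C : ℝ, 0 ≤ C ∧
    ∀ t : ℝ, 2 ≤ t → (dyadicIndex a (B * t) : ℝ) + 1 ≤ C * Real.log t := by
  have hl2 : 0 < Real.log 2 := Real.log_pos one_lt_two
  have hBa : 0 ≤ Real.log (B / a) := Real.log_nonneg ((one_le_div ha).2 haB)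
  refine ⟨(Real.log (B / a) / Real.log 2 + 1) / Real.log 2 + 1 / Real.log 2, by positivity,
    fun t ht ↦ ?_⟩
  have ht0 : 0 < t := by linarith
  have hB : 0 < B := ha.trans_le haB
  have hlt : Real.log 2 ≤ Real.log t := Real.log_le_log two_pos ht
  have h1 := (dyadicIndex_spec ha (show a ≤ B * t by nlinarith)).1
  have h2 : (2 : ℝ) ^ dyadicIndex a (B * t) ≤ B / a * t := by
    rw [div_mul_eq_mul_div, le_div_iff₀ ha]; linarith
  have h3 := Real.log_le_log (by positivity) h2
  rw [Real.log_pow, Real.log_mul (by positivity) ht0.ne'] at h3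
  have h4 : (dyadicIndex a (B * t) : ℝ) ≤ Real.log (B / a) / Real.log 2 + Real.log t / Real.log 2 := by
    rw [← add_div, le_div_iff₀ hl2]; exact h3
  have h5 : Real.log (B / a) / Real.log 2 + 1 ≤
      (Real.log (B / a) / Real.log 2 + 1) / Real.log 2 * Real.log t := by
    rw [div_mul_eq_mul_div, le_div_iff₀ hl2]
    gcongr
  have h6 : 1 / Real.log 2 * Real.log t = Real.log t / Real.log 2 := by ring
  rw [add_mul, h6]
  linarith

theorem card_filter_barnesLin_le {r : ℕ} {w : Fin r → ℝ} (hw : ∀ j, 0 < w j) {a : ℝ} (ha : 0 < a) :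
    ∃ D : ℝ, 0 ≤ D ∧ ∀ (N : ℕ) (M : ℝ), a ≤ M →
      ((Finset.univ.filter fun m : Fin r → Fin N ↦
        barnesLin w a (fun j ↦ (m j : ℕ)) ≤ 2 * M).card : ℝ) ≤ D * M ^ r := by
  refine ⟨∏ j, (2 / w j + 1 / a), Finset.prod_nonneg fun j _ ↦ ?_, fun N M hM ↦ ?_⟩
  · have := hw j; positivity
  have hM0 : 0 < M := ha.trans_le hM
  have hsub : (Finset.univ.filter fun m : Fin r → Fin N ↦
      barnesLin w a (fun j ↦ (m j : ℕ)) ≤ 2 * M) ⊆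
      Fintype.piFinset fun j ↦ Finset.univ.filter fun n : Fin N ↦ ((n : ℕ) : ℝ) * w j ≤ 2 * M := by
    intro m hm
    rw [Fintype.mem_piFinset]
    intro j
    simp only [Finset.mem_filter, Finset.mem_univ, true_and] at hm ⊢
    have h1 : ((m j : ℕ) : ℝ) * w j ≤ ∑ j, ((m j : ℕ) : ℝ) * w j :=
      Finset.single_le_sum (f := fun j ↦ ((m j : ℕ) : ℝ) * w j)
        (fun i _ ↦ mul_nonneg (Nat.cast_nonneg _) (hw i).le) (Finset.mem_univ j)
    unfold barnesLin at hm
    linarith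
  have hcard := Finset.card_le_card hsub
  rw [Fintype.card_piFinset] at hcard
  refine (Nat.cast_le.2 hcard).trans ?_
  rw [Nat.cast_prod]
  calc ∏ j, ((Finset.univ.filter fun n : Fin N ↦ ((n : ℕ) : ℝ) * w j ≤ 2 * M).card : ℝ)
      ≤ ∏ j, ((2 / w j + 1 / a) * M) := by
        refine Finset.prod_le_prod (fun _ _ ↦ Nat.cast_nonneg _) fun j _ ↦ ?_
        have hwj := hw j
        have h1 : (Finset.univ.filter fun n : Fin N ↦ ((n : ℕ) : ℝ) * w j ≤ 2 * M).card ≤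
            (Finset.range (⌊2 * M / w j⌋₊ + 1)).card := by
          refine Finset.card_le_card_of_injOn (fun n ↦ (n : ℕ)) (fun n hn ↦ ?_)
            (Fin.val_injective.injOn)
          simp only [Finset.coe_filter, Finset.mem_univ, true_and, mem_ofPred_eq] at hn
          simp only [Finset.coe_range, mem_Iio, Nat.lt_succ_iff]
          exact Nat.le_floor ((le_div_iff₀ hwj).2 hn)
        rw [Finset.card_range] at h1
        have h2 := Nat.floor_le (show 0 ≤ 2 * M / w j by positivity)
        have h3 : ((Finset.univ.filter fun n : Fin N ↦ ((n : ℕ) : ℝ) * w j ≤ 2 * M).card : ℝ) ≤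
          ⌊2 * M / w j⌋₊ + 1 := by exact_mod_cast h1
        have h4 : 1 ≤ M / a := (one_le_div ha).2 hM
        have h5 : (2 / w j + 1 / a) * M = 2 * M / w j + M / a := by ring
        rw [h5]; linarith
    _ = _ := by
        rw [Finset.prod_mul_distrib, Finset.prod_const, Finset.card_univ, Fintype.card_fin]

/-- `G` majorises the contribution of every shell up to constants, and the number of shells supplies
the logarithm. Leaving `G` free lets one estimate serve both ranges of `σ`. -/
theorem norm_barnesBoxSum_le {r : ℕ} {w : Fin (r + 1) → ℝ} (hw : ∀ j, 0 < w j) {a : ℝ}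
    (ha : 0 < a) (σ₀ σ₁ : ℝ) {R : ℝ} (hR : 0 ≤ R) : ∃ B : ℝ, a ≤ B ∧ ∃ C : ℝ, 0 ≤ C ∧
    ∀ (s : ℂ) (N : ℕ) (G : ℝ), σ₀ ≤ s.re → s.re ≤ σ₁ → 2 ≤ s.im → N ≤ R * s.im →
      (∀ M : ℝ, a ≤ M → M ≤ B * s.im → M ^ ((r : ℝ) - s.re) * min M √s.im ≤ G) →
      ‖barnesBoxSum w N s a‖ ≤ C * (G * Real.log s.im) := by
  have hw' : ∀ j, 0 < Fin.tail w j := fun j ↦ hw _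
  have hw0 := hw 0
  have hsw : 0 ≤ ∑ j, w j := Finset.sum_nonneg fun j _ ↦ (hw j).le
  -- On the box the linear form is at most `a + R t ∑ w_j ≤ B t`.
  set B : ℝ := a + R * ∑ j, w j with hB
  have haB : a ≤ B := le_add_of_nonneg_right (mul_nonneg hR hsw)
  have hB0 : 0 < B := ha.trans_le haB
  obtain ⟨C₁, hC₁, hprog⟩ := norm_sum_cpow_progression_le hw0 hB0.le ha σ₀ σ₁
  obtain ⟨C₂, hC₂, hlog⟩ := exists_dyadicIndex_le_log ha haB
  obtain ⟨D, hD, hcard⟩ := card_filter_barnesLin_le hw' ha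
  refine ⟨B, haB, C₂ * (D * C₁), by positivity, fun s N G h0 h1 ht hN hG ↦ ?_⟩
  have ht0 : 0 < s.im := by linarith
  set K := dyadicIndex a (B * s.im) + 1 with hK
  set L : (Fin r → Fin N) → ℝ := fun m ↦ barnesLin (Fin.tail w) a (fun j ↦ (m j : ℕ)) with hL
  have hLa : ∀ m, a ≤ L m := fun m ↦ le_barnesLin hw' a _
  have hya : ∀ m (n : ℕ), a ≤ L m + n * w 0 := fun m n ↦
    (hLa m).trans (le_add_of_nonneg_right (by positivity))
  have hLB : ∀ m, ∀ n ∈ Finset.range N, L m + n * w 0 ≤ B * s.im := by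
    intro m n hn
    have hnN : (n : ℝ) ≤ R * s.im :=
      le_trans (by exact_mod_cast (Finset.mem_range.1 hn).le) hN
    have hj : ∀ j ∈ Finset.univ, (((m j : ℕ) : ℝ)) * Fin.tail w j ≤ R * s.im * Fin.tail w j := by
      intro j _
      refine mul_le_mul_of_nonneg_right (le_trans ?_ hN) (hw' j).le
      exact_mod_cast (m j).2.le
    have h2 := Finset.sum_le_sum hj
    rw [← Finset.mul_sum] at h2
    have h3 : ∑ j, w j = w 0 + ∑ j, Fin.tail w j := by rw [Fin.sum_univ_succ]; rfl
    have h4 : (n : ℝ) * w 0 ≤ R * s.im * w 0 := by gcongr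
    simp only [hL, barnesLin]
    rw [hB, h3]
    nlinarith
  have hmaps : ∀ m, ∀ n ∈ Finset.range N, dyadicIndex a (L m + n * w 0) ∈ Finset.range K := by
    intro m n hn
    rw [Finset.mem_range, hK, Nat.lt_succ_iff]
    exact dyadicIndex_mono ha (hLB m n hn)
  have hMB : ∀ k ∈ Finset.range K, a * 2 ^ k ≤ B * s.im := by
    intro k hk
    have hk' : k ≤ dyadicIndex a (B * s.im) := by
      have := Finset.mem_range.1 hk; omega
    have h2 := (dyadicIndex_spec ha (show a ≤ B * s.im by nlinarith)).1
    refine le_trans ?_ h2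
    gcongr
    norm_num
  have haM : ∀ k : ℕ, a ≤ a * 2 ^ k := fun k ↦ le_mul_of_one_le_right ha.le (one_le_pow₀ (by norm_num))
  -- For fixed `m` the indices `n` in a shell form an interval, hence a progression of values. If `L
  -- m` already exceeds the shell the interval is empty, and the indicator keeps the count of `m` at
  -- `≪ M^r`.
  have hshell : ∀ k ∈ Finset.range K, ∀ m,
      ‖∑ n ∈ Finset.range N with dyadicIndex a (L m + (n : ℕ) * w 0) = k,
        ((L m + n * w 0 : ℝ) : ℂ) ^ (-s)‖ ≤
      if L m ≤ 2 * (a * 2 ^ k) then C₁ * ((a * 2 ^ k) ^ (-s.re) * min (a * 2 ^ k) √s.im) else 0 := by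
    intro k hk m
    have hmem : ∀ n, n ∈ Finset.filter (fun n : ℕ ↦ dyadicIndex a (L m + n * w 0) = k)
        (Finset.range N) ↔ n < N ∧ dyadicIndex a (L m + n * w 0) = k := fun n ↦ by
      rw [Finset.mem_filter, Finset.mem_range]
    obtain ⟨p, n, hpn⟩ := Finset.exists_eq_Ico_of_ordConnected
      (Finset.filter (fun n : ℕ ↦ dyadicIndex a (L m + n * w 0) = k) (Finset.range N)) (by
        intro i hi l hl j hij hjl
        rw [hmem] at hi hl ⊢
        refine ⟨by omega, le_antisymm ?_ ?_⟩
        · rw [← hl.2]; exact dyadicIndex_mono ha (by gcongr)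
        · rw [← hi.2]; exact dyadicIndex_mono ha (by gcongr))
    rw [hpn]
    have hin : ∀ i < n, a * 2 ^ k ≤ (L m + p * w 0) + i * w 0 ∧
        (L m + p * w 0) + i * w 0 ≤ 2 * (a * 2 ^ k) := by
      intro i hi
      have h2 := (hmem (p + i)).1 (by rw [hpn, Finset.mem_Ico]; omega)
      have h3 := dyadicIndex_spec ha (hya m (p + i))
      rw [h2.2] at h3
      have e : L m + p * w 0 + i * w 0 = L m + ((p + i : ℕ) : ℝ) * w 0 := by push_cast; ring
      rw [e]; exact h3
    split_ifs with hif
    · rw [Finset.sum_Ico_eq_sum_range, Nat.add_sub_cancel_left]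
      have h2 := hprog s (L m + p * w 0) (a * 2 ^ k) n h0 h1 (by linarith) (haM k) (hMB k hk) hin
      refine le_trans (le_of_eq ?_) h2
      congr 1
      refine Finset.sum_congr rfl fun i _ ↦ ?_
      congr 2
      push_cast; ring
    · rcases Nat.eq_zero_or_pos n with hn | hn
      · simp [hn]
      · exfalso
        have h2 := (hin 0 hn).2
        have h3 : 0 ≤ (p : ℝ) * w 0 := by positivity
        simp only [Nat.cast_zero, zero_mul, add_zero] at h2
        exact hif (by linarith)
  rw [barnesBoxSum_succ]
  have hsplit : ∀ m : Fin r → Fin N, ∑ n ∈ Finset.range N,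
      ((barnesLin (Fin.tail w) a (fun j ↦ (m j : ℕ)) + n * w 0 : ℝ) : ℂ) ^ (-s) =
      ∑ k ∈ Finset.range K, ∑ n ∈ Finset.range N with dyadicIndex a (L m + (n : ℕ) * w 0) = k,
        ((L m + n * w 0 : ℝ) : ℂ) ^ (-s) := fun m ↦
    (Finset.sum_fiberwise_of_maps_to (hmaps m) _).symm
  rw [Finset.sum_congr rfl fun m _ ↦ hsplit m, Finset.sum_comm]
  have hk : ∀ k ∈ Finset.range K, ‖∑ m : Fin r → Fin N,
      ∑ n ∈ Finset.range N with dyadicIndex a (L m + (n : ℕ) * w 0) = k,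
        ((L m + n * w 0 : ℝ) : ℂ) ^ (-s)‖ ≤ D * C₁ * G := by
    intro k hk
    refine (norm_sum_le_of_le _ fun m _ ↦ hshell k hk m).trans ?_
    have hM0 : 0 < a * 2 ^ k := by positivity
    rw [← Finset.sum_filter, Finset.sum_const, nsmul_eq_mul]
    have h2 := hcard N (a * 2 ^ k) (haM k)
    have h3 := hG _ (haM k) (hMB k hk)
    have e : (a * 2 ^ k) ^ ((r : ℝ) - s.re) = (a * 2 ^ k) ^ r * (a * 2 ^ k) ^ (-s.re) := by
      rw [sub_eq_add_neg, Real.rpow_add hM0, Real.rpow_natCast]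
    have hP : 0 ≤ (a * 2 ^ k) ^ (-s.re) * min (a * 2 ^ k) √s.im := by positivity
    calc _ ≤ D * (a * 2 ^ k) ^ r * (C₁ * ((a * 2 ^ k) ^ (-s.re) * min (a * 2 ^ k) √s.im)) := by
          gcongr
      _ = D * C₁ * ((a * 2 ^ k) ^ ((r : ℝ) - s.re) * min (a * 2 ^ k) √s.im) := by rw [e]; ring
      _ ≤ D * C₁ * G := by gcongr
  refine (norm_sum_le_of_le _ hk).trans ?_
  rw [Finset.sum_const, Finset.card_range, nsmul_eq_mul]
  have hKlog := hlog s.im ht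
  have hG0 : 0 ≤ G := le_trans (by positivity) (hG a le_rfl (by nlinarith))
  rw [hK]; push_cast
  calc ((dyadicIndex a (B * s.im) : ℝ) + 1) * (D * C₁ * G)
      ≤ C₂ * Real.log s.im * (D * C₁ * G) := by gcongr
    _ = _ := by ring

/-! ### Bounds in the two strips -/

theorem norm_barnesCont_strip_le {r : ℕ} {w : Fin (r + 1) → ℝ} (hw : ∀ j, 0 < w j) {a : ℝ}
    (ha : 0 < a) (σ₀ σ₁ : ℝ) : ∃ B : ℝ, a ≤ B ∧ ∃ C : ℝ, 0 ≤ C ∧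
    ∀ (s : ℂ) (G : ℝ), σ₀ ≤ s.re → s.re ≤ σ₁ → 2 ≤ s.im →
      (∀ M : ℝ, a ≤ M → M ≤ B * s.im → M ^ ((r : ℝ) - s.re) * min M √s.im ≤ G) →
      ‖barnesCont w s a‖ ≤ C * (s.im ^ ((r : ℝ) - s.re) + G * Real.log s.im) := by
  obtain ⟨Y, hY1, hY⟩ := norm_barnesCont_sub_boxSum_le (r + 1) w hw σ₀ σ₁
  obtain ⟨C₁, hC₁, happrox⟩ := hY Y le_rfl a
  obtain ⟨B, hB, C₂, hC₂, hbox⟩ := norm_barnesBoxSum_le hw ha σ₀ σ₁ (R := 2 * Y) (by linarith)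
  refine ⟨B, hB, C₁ + C₂, by positivity, fun s G h0 h1 ht hG ↦ ?_⟩
  have ht0 : 0 < s.im := by linarith
  have hN1 := Nat.le_ceil (Y * s.im)
  have hN2 : (⌈Y * s.im⌉₊ : ℝ) ≤ 2 * Y * s.im := by
    have := (Nat.ceil_lt_add_one (show 0 ≤ Y * s.im by positivity)).le
    nlinarith
  have b1 := happrox s a ⌈Y * s.im⌉₊ h0 h1 (by linarith) ha (by nlinarith) hN1 hN2
  have b2 := hbox s ⌈Y * s.im⌉₊ G h0 h1 ht hN2 hG
  push_cast at b1
  rw [show (r : ℝ) + 1 - 1 - s.re = r - s.re by ring] at b1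
  have hlog : 0 ≤ Real.log s.im := Real.log_nonneg (by linarith)
  have hpow := Real.rpow_nonneg ht0.le ((r : ℝ) - s.re)
  have b3 := norm_add_le (barnesCont w s a - barnesBoxSum w ⌈Y * s.im⌉₊ s a)
    (barnesBoxSum w ⌈Y * s.im⌉₊ s a)
  rw [sub_add_cancel] at b3
  have hG0 : 0 ≤ G * Real.log s.im :=
    mul_nonneg (le_trans (by positivity) (hG a le_rfl (by nlinarith))) hlog
  nlinarith [mul_nonneg hC₁ hG0, mul_nonneg hC₂ hpow]

theorem one_le_log_div_log_two {t : ℝ} (ht : 2 ≤ t) : 1 ≤ 1 / Real.log 2 * Real.log t := by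
  rw [one_div_mul_eq_div, one_le_div (Real.log_pos one_lt_two)]
  exact Real.log_le_log two_pos ht

theorem norm_barnesCont_critical_strip_le {r : ℕ} {w : Fin (r + 1) → ℝ} (hw : ∀ j, 0 < w j) {a : ℝ}
    (ha : 0 < a) : ∃ C : ℝ, ∀ s : ℂ, (r : ℝ) < s.re → s.re ≤ r + 1 → 2 ≤ s.im →
      ‖barnesCont w s a‖ ≤ C * (s.im ^ (((r : ℝ) + 1 - s.re) / 2) * Real.log s.im) := by
  obtain ⟨B, hB, C, hC, h⟩ := norm_barnesCont_strip_le hw ha r (r + 1)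
  refine ⟨C * (1 / Real.log 2 + 1), fun s h0 h1 ht ↦ ?_⟩
  have ht0 : 0 < s.im := by linarith
  have hlog : 0 ≤ Real.log s.im := Real.log_nonneg (by linarith)
  have hG := h s (s.im ^ (((r : ℝ) + 1 - s.re) / 2)) h0.le h1 ht (by
    intro M haM _
    have hM : 0 < M := ha.trans_le haM
    set θ : ℝ := (r : ℝ) + 1 - s.re with hθ
    have hsq : (√s.im) ^ θ = s.im ^ (θ / 2) := by
      rw [Real.sqrt_eq_rpow, ← Real.rpow_mul ht0.le]; congr 1; ring
    have hmin : 0 < min M √s.im := lt_min hM (Real.sqrt_pos.2 ht0)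
    -- The weights `1 - θ` and `θ` lie in `[0, 1]` exactly in this strip, and `M ^ (r - s.re) * M ^
    -- (1 - θ) = 1`, so the bound is independent of `M`.
    have hle : min M √s.im ≤ M ^ (1 - θ) * (√s.im) ^ θ := by
      have e : min M √s.im = (min M √s.im) ^ (1 - θ) * (min M √s.im) ^ θ := by
        rw [← Real.rpow_add hmin]; simp
      rw [e]
      refine mul_le_mul ?_ ?_ (Real.rpow_nonneg hmin.le _) (Real.rpow_nonneg hM.le _)
      · exact Real.rpow_le_rpow hmin.le (min_le_left _ _) (by linarith)
      · exact Real.rpow_le_rpow hmin.le (min_le_right _ _) (by linarith)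
    calc M ^ ((r : ℝ) - s.re) * min M √s.im
        ≤ M ^ ((r : ℝ) - s.re) * (M ^ (1 - θ) * (√s.im) ^ θ) := by gcongr
      _ = M ^ ((r : ℝ) - s.re + (1 - θ)) * (√s.im) ^ θ := by rw [Real.rpow_add hM]; ring
      _ = s.im ^ (θ / 2) := by
        rw [show (r : ℝ) - s.re + (1 - θ) = 0 by rw [hθ]; ring, Real.rpow_zero, one_mul, hsq])
  refine hG.trans ?_
  have h2 : s.im ^ ((r : ℝ) - s.re) ≤ s.im ^ (((r : ℝ) + 1 - s.re) / 2) :=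
    Real.rpow_le_rpow_of_exponent_le (by linarith) (by linarith)
  have hP := Real.rpow_pos_of_pos ht0 (((r : ℝ) + 1 - s.re) / 2)
  rw [mul_assoc]
  refine mul_le_mul_of_nonneg_left ?_ hC
  have h3 := mul_le_mul_of_nonneg_left (one_le_log_div_log_two ht) hP.le
  rw [mul_one] at h3
  linarith

theorem norm_barnesCont_left_le {r : ℕ} {w : Fin (r + 1) → ℝ} (hw : ∀ j, 0 < w j) {a : ℝ}
    (ha : 0 < a) (σ₀ : ℝ) : ∃ C : ℝ, ∀ s : ℂ, σ₀ ≤ s.re → s.re ≤ r → 2 ≤ s.im →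
      ‖barnesCont w s a‖ ≤ C * (s.im ^ ((r : ℝ) + 1 - s.re - 1 / 2) * Real.log s.im) := by
  obtain ⟨B, hB, C, hC, h⟩ := norm_barnesCont_strip_le hw ha σ₀ r
  -- `D` bounds `B ^ (r - s.re)` uniformly; the exponent is nonnegative here, so `M ≤ B t` is the
  -- worst case.
  obtain ⟨D, hD, hpow⟩ := exists_rpow_le B B 0 ((r : ℝ) - σ₀) (ha.trans_le hB)
  refine ⟨C * (1 / Real.log 2 + D), fun s h0 h1 ht ↦ ?_⟩
  have ht0 : 0 < s.im := by linarith
  have hB0 : 0 < B := ha.trans_le hB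
  have hP := Real.rpow_pos_of_pos ht0 ((r : ℝ) + 1 - s.re - 1 / 2)
  have hG := h s (D * s.im ^ ((r : ℝ) + 1 - s.re - 1 / 2)) h0 h1 ht (by
    intro M haM hMB
    have hM : 0 < M := ha.trans_le haM
    have e1 : M ^ ((r : ℝ) - s.re) ≤ D * s.im ^ ((r : ℝ) - s.re) := by
      refine (Real.rpow_le_rpow hM.le hMB (by linarith)).trans ?_
      rw [Real.mul_rpow hB0.le ht0.le]
      gcongr
      exact hpow _ _ le_rfl le_rfl (by linarith) (by linarith)
    calc M ^ ((r : ℝ) - s.re) * min M √s.im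
        ≤ D * s.im ^ ((r : ℝ) - s.re) * √s.im := by
          refine mul_le_mul e1 (min_le_right _ _) (by positivity) (by positivity)
      _ = D * s.im ^ ((r : ℝ) + 1 - s.re - 1 / 2) := by
          rw [Real.sqrt_eq_rpow, mul_assoc, ← Real.rpow_add ht0]
          congr 2; ring)
  refine hG.trans ?_
  have h2 : s.im ^ ((r : ℝ) - s.re) ≤ s.im ^ ((r : ℝ) + 1 - s.re - 1 / 2) :=
    Real.rpow_le_rpow_of_exponent_le (by linarith) (by linarith)
  rw [mul_assoc C]
  refine mul_le_mul_of_nonneg_left ?_ hC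
  have h3 := mul_le_mul_of_nonneg_left (one_le_log_div_log_two ht) hP.le
  rw [mul_one] at h3
  linarith

/-! ### Absolute convergence, uniqueness of the continuation, and the conclusion -/

theorem norm_barnesSeries_le_of_re {r : ℕ} {w : Fin r → ℝ} (hw : ∀ j, 0 < w j) {a : ℝ}
    (ha : 0 < a) {σ₀ : ℝ} (σ₁ : ℝ) (h : (r : ℝ) < σ₀) : ∃ C : ℝ, ∀ s : ℂ, σ₀ ≤ s.re → s.re ≤ σ₁ →
      ‖barnesSeries w s a‖ ≤ C := by
  have hrn : (0 : ℝ) ≤ r := Nat.cast_nonneg r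
  refine ⟨_, fun s h0 h1 ↦ tsum_of_norm_bounded
    ((barnes_summable_rpow hw h ha).mul_left (max 1 (a ^ (-(σ₁ - σ₀))))).hasSum
    fun m ↦ norm_cpow_barnesLin_le hw (by linarith) ha le_rfl h0 h1 m⟩

theorem isBarnesContinuation_barnesCont {r : ℕ} {w : Fin r → ℝ} (hw : ∀ j, 0 < w j) {a : ℝ}
    (ha : 0 < a) : IsBarnesContinuation r a w (fun s ↦ barnesCont w s a) := by
  have hE := (isBarnesNumerator_barnesNumerator hw).differentiable a ha
  refine ⟨fun s hs ↦ ?_, ?_, ?_⟩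
  · simp only [barnesCont_eq_series hw hs ha, one_div, ← Complex.cpow_neg]
    exact hasSum_barnesSeries hw hs ha
  · intro s
    exact (hE.analyticAt s).meromorphicAt.div
      ((differentiable_barnesDenom r).analyticAt s).meromorphicAt
  · exact hE.differentiableOn.div (differentiable_barnesDenom r).differentiableOn
      fun s hs ↦ barnesDenom_ne_zero hs

/-- The plane minus finitely many points is connected, so the identity theorem applies. This
transfers the bounds to `barnesZeta`, which is defined by an arbitrary choice. -/
theorem IsBarnesContinuation.eqOn {r : ℕ} {a : ℝ} {w : Fin r → ℝ} {Z Z' : ℂ → ℂ}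
    (hZ : IsBarnesContinuation r a w Z) (hZ' : IsBarnesContinuation r a w Z') :
    EqOn Z Z' {s : ℂ | ∀ k : ℕ, 1 ≤ k → k ≤ r → s ≠ (k : ℂ)} := by
  set U : Set ℂ := {s : ℂ | ∀ k : ℕ, 1 ≤ k → k ≤ r → s ≠ (k : ℂ)} with hU
  set F : Set ℂ := (fun k : ℕ ↦ (k : ℂ)) '' Icc 1 r with hF
  have hUF : U = Fᶜ := by
    ext s
    simp only [hU, hF, mem_ofPred_eq, mem_compl_iff, mem_image, mem_Icc, not_exists, not_and,
      and_imp]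
    exact forall_congr' fun k ↦ forall_congr' fun _ ↦ forall_congr' fun _ ↦ ne_comm
  have hfin : F.Finite := (finite_Icc 1 r).image _
  have hopen : IsOpen U := hUF ▸ hfin.isClosed.isOpen_compl
  have hconn : IsPreconnected U := by
    rw [hUF]
    exact (hfin.countable.isConnected_compl_of_one_lt_rank
      (by rw [Complex.rank_real_complex]; norm_num)).isPreconnected
  have hmem : ∀ s : ℂ, (r : ℝ) < s.re → s ∈ U := by
    rintro s hs k - hk rfl
    rw [Complex.natCast_re] at hs
    exact absurd (Nat.cast_lt.1 hs) (by omega)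
  have hnhds : {s : ℂ | (r : ℝ) < s.re} ∈ 𝓝 (((r : ℝ) + 1 : ℝ) : ℂ) :=
    (isOpen_lt continuous_const Complex.continuous_re).mem_nhds (by simp)
  refine AnalyticOnNhd.eqOn_of_preconnected_of_eventuallyEq
    (hZ.differentiableOn.analyticOnNhd hopen) (hZ'.differentiableOn.analyticOnNhd hopen) hconn
    (z₀ := (((r : ℝ) + 1 : ℝ) : ℂ)) (hmem _ (by simp)) ?_
  filter_upwards [hnhds] with s hs using (hZ.hasSum s hs).unique (hZ'.hasSum s hs)

theorem isBarnesContinuation_barnesZeta {r : ℕ} {w : Fin r → ℝ} (hw : ∀ j, 0 < w j) {a : ℝ}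
    (ha : 0 < a) : IsBarnesContinuation r a w (barnesZeta r a w) := by
  have h : ∃ Z, IsBarnesContinuation r a w Z := ⟨_, isBarnesContinuation_barnesCont hw ha⟩
  rw [barnesZeta, dif_pos h]
  exact h.choose_spec

theorem barnesZeta_eq_barnesCont {r : ℕ} {w : Fin r → ℝ} (hw : ∀ j, 0 < w j) {a : ℝ}
    (ha : 0 < a) {s : ℂ} (hs : s.im ≠ 0) : barnesZeta r a w s = barnesCont w s a :=
  (isBarnesContinuation_barnesZeta hw ha).eqOn (isBarnesContinuation_barnesCont hw ha)
    fun k _ _ h ↦ hs (by rw [h, Complex.natCast_im])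

theorem theorem1p4 (r : ℕ) (hr : 1 ≤ r) (a : ℝ) (ha : 0 < a)
    (w : Fin r → ℝ) (hw : ∀ j, 0 < w j) :
    IsBarnesContinuation r a w (barnesZeta r a w) ∧
    (∀ σ₀ σ₁ : ℝ, (r : ℝ) < σ₀ → ∃ C : ℝ, ∀ σ t : ℝ, σ₀ ≤ σ → σ ≤ σ₁ → 2 ≤ t →
      ‖barnesZeta r a w (σ + t * Complex.I)‖ ≤ C) ∧
    (∃ C : ℝ, ∀ σ t : ℝ, (r : ℝ) - 1 < σ → σ ≤ r → 2 ≤ t →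
      ‖barnesZeta r a w (σ + t * Complex.I)‖ ≤ C * (t ^ (((r : ℝ) - σ) / 2) * Real.log t)) ∧
    (∀ σ₀ : ℝ, ∃ C : ℝ, ∀ σ t : ℝ, σ₀ ≤ σ → σ ≤ (r : ℝ) - 1 → 2 ≤ t →
      ‖barnesZeta r a w (σ + t * Complex.I)‖ ≤
        C * (t ^ ((r : ℝ) - σ - 1 / 2) * Real.log t)) := by
  obtain ⟨r, rfl⟩ : ∃ n, r = n + 1 := ⟨r - 1, by omega⟩
  have hre : ∀ σ t : ℝ, ((σ : ℂ) + t * Complex.I).re = σ := fun σ t ↦ by simp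
  have him : ∀ σ t : ℝ, ((σ : ℂ) + t * Complex.I).im = t := fun σ t ↦ by simp
  have heq : ∀ σ t : ℝ, 2 ≤ t → barnesZeta (r + 1) a w (σ + t * Complex.I) =
      barnesCont w (σ + t * Complex.I) a := fun σ t ht ↦
    barnesZeta_eq_barnesCont hw ha (by rw [him]; linarith)
  refine ⟨isBarnesContinuation_barnesZeta hw ha, fun σ₀ σ₁ h ↦ ?_, ?_, fun σ₀ ↦ ?_⟩
  · obtain ⟨C, hC⟩ := norm_barnesSeries_le_of_re hw ha σ₁ h
    refine ⟨C, fun σ t h0 h1 ht ↦ ?_⟩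
    rw [heq σ t ht, barnesCont_eq_series hw (by rw [hre]; linarith) ha]
    exact hC _ (by rwa [hre]) (by rwa [hre])
  · obtain ⟨C, hC⟩ := norm_barnesCont_critical_strip_le hw ha
    refine ⟨C, fun σ t h0 h1 ht ↦ ?_⟩
    push_cast at h0 h1 ⊢
    have h2 := hC (σ + t * Complex.I) (by rw [hre]; linarith) (by rwa [hre]) (by rwa [him])
    rw [hre, him] at h2
    rw [heq σ t ht]
    exact h2
  · obtain ⟨C, hC⟩ := norm_barnesCont_left_le hw ha σ₀
    refine ⟨C, fun σ t h0 h1 ht ↦ ?_⟩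
    push_cast at h0 h1 ⊢
    have h2 := hC (σ + t * Complex.I) (by rwa [hre]) (by rw [hre]; linarith) (by rwa [him])
    rw [hre, him] at h2
    rw [heq σ t ht]
    exact h2
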